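/- For integers $k\ge 3$, $n,m\ge 1$ let $\mathcal D_k(n,m)$ be the probability distribution on $\mathbb Z^n$ of the degree sequence of a uniformly random $k$-uniform hypergraph with vertex set $[n]$ and exactly $m$ edges (edges are distinct $k$-element subsets of $[n]$). Let $\mathcal B_k(n,m)$ be the distribution of a sequence of $n$ independent $\mathrm{Bin}\bigl(\binom{n-1}{k-1},p\bigr)$ random variables conditioned on their sum being $km$, where $p\in(0,1)$ (the conditioned distribution does not depend on $p$). For $\mathbf d=(d_1,\dots,d_n)\in\mathbb Z^n$ put $\sigma^2(\mathbf d)=\frac1n\sum_{v=1}^n (d_v-\bar d)^2$, where $\bar d=\frac1n\sum_{v} d_v$. Let $n,k,m,\Delta_*$ be positive integers with $k\ge3$, and define $$\psi_k=\begin{cases}\dfrac1m\left(\Delta_*^3+\log^9 n\right), & k=3,\\[2mm] \dfrac{k^2}{m}\left(\Delta_*^2+k\Delta_*\log^4 n+k^2\log^9 n\right), & k\ge4.\end{cases}$$ Assume $\psi_k<1$. Then, uniformly for all sequences $\mathbf d\in\mathbb Z^n$ with $\sum_{v}d_v=km$ and $\max_v d_v\le\Delta_*$, $$\mathbb P_{\mathcal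 D_k(n,m)}(\mathbf d)=\mathbb P_{\mathcal B_k(n,m)}(\mathbf d)\,\exp\left(\frac{k-1}{2}\left(1-\frac{n\,\sigma^2(\mathbf d)}{km}\right)\right)\left(1+O\left(\sqrt{\psi_k}\right)\right)\qquad(n\to\infty).$$ Here uniformity means that there are absolute constants $C$ and $N$ such that, for all $n\ge N$ and all $k,m,\Delta_*,\mathbf d$ as above, the equality holds with the last factor replaced by $1+\varepsilon$ for some real $\varepsilon$ with $|\varepsilon|\le C\sqrt{\psi_k}$. -/

import Mathlib

open MeasureTheory ProbabilityTheory

noncomputable section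

namespace SparseHypergraph

/-- The `k`-uniform hypergraphs on the vertex set `Fin n` with exactly `m` edges: a hypergraph is
its set of edges, which are `k`-element sets of vertices. -/
def kGraphs (k n m : ℕ) : Finset (Finset (Finset (Fin n))) :=
  ((Finset.univ : Finset (Fin n)).powersetCard k).powersetCard m

/-- The degree sequence of a hypergraph: `v` is sent to the number of edges containing `v`. -/
def degSeq {n : ℕ} (H : Finset (Finset (Fin n))) : Fin n → ℤ :=
  fun v => ((H.filter (fun e => v ∈ e)).card : ℤ)

/-- The probability that a uniformly random `k`-uniform hypergraph on `n` vertices with `m` edges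
has degree sequence `d`. -/
def probD (k n m : ℕ) (d : Fin n → ℤ) : ℝ :=
  (((kGraphs k n m).filter (fun H => degSeq H = d)).card : ℝ) / ((kGraphs k n m).card : ℝ)

/-- The integer sequences of length `n` with sum `k * m`. -/
def Omega (k n m : ℕ) : Set (Fin n → ℤ) := {d | ∑ v, d v = (k : ℤ) * m}

/-- The law of `n` independent random variables with the binomial distribution
`Bin (binom (n-1) (k-1), p)` (as integer-valued random variables), conditioned on having
sum `k * m`. -/
def lawB (k n m : ℕ) (p : unitInterval) : Measure (Fin n → ℤ) :=
  ProbabilityTheory.cond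
    (Measure.pi fun _ : Fin n =>
      (ProbabilityTheory.binomial ((n - 1).choose (k - 1)) p).map (Nat.cast : ℕ → ℤ))
    (Omega k n m)

/-- The probability of the sequence `d` under the conditioned binomial law. -/
def probB (k n m : ℕ) (p : unitInterval) (d : Fin n → ℤ) : ℝ := (lawB k n m p).real {d}

/-- The variance `(1/n) ∑ (d_v - avg)^2` of a sequence of length `n` with average `avg`. -/
def sigmaSq {n : ℕ} (d : Fin n → ℤ) : ℝ :=
  (1 / (n : ℝ)) * ∑ v, ((d v : ℝ) - (∑ w, (d w : ℝ)) / n) ^ 2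

/-- The error parameter `ψ_k` (used for `k ≥ 3` only). -/
def psi (k n m D : ℕ) : ℝ :=
  if k = 3 then (1 / (m : ℝ)) * ((D : ℝ) ^ 3 + Real.log n ^ 9)
  else ((k : ℝ) ^ 2 / m) *
    ((D : ℝ) ^ 2 + k * D * Real.log n ^ 4 + (k : ℝ) ^ 2 * Real.log n ^ 9)

end SparseHypergraph

end

/-!
The number of hypergraphs with degrees `d` is compared with an explicit weight in three stages.

*Families without loops.* `edgeSeqs ι k d` is the set of sequences of `m` edges (`k`-sets, possibly
repeated) with degrees `d`. Without the requirement that the vertices of an edge be distinct, the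
corresponding count is `configWeight = (k m)! / (k! ^ m ∏ d_v!)`, so the number of families is
`configWeight` times the probability that a random configuration has no loop. This probability is
`exp (-λ (1 + O (D / m)))`, where `λ = loopMean = (k - 1) ∑ d_v (d_v - 1) / (2 k m)`
(`card_edgeSeqs_bounds`). The proof splits the vertices into vertices of degree one, for which the
probability is one. Splitting one incidence of `a` off into a new vertex `b` of degree one
multiplies the probability of having no loop by the reciprocal of `1 - P (a and b share an edge)`
(`degree_mul_card_edgeSeqs`). Exchanging the incidence of `b` with a random incidence preserves the
uniform distribution, and after an exchange `b` lies in a random edge; so that probability is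
`(d_a - 1) (k - 1) / (k m)` up to a relative error `O (D / m)`, which comes from exchanges that would
create a loop (`card_adjacent_mul_le`, `le_card_adjacent_mul`). All degrees stay at most `D` and `m`
does not change along the way, so the relative errors are uniform and the total error in the
exponent is `O (λ D / m) = O (k D² / m)`.

*Repeated edges.* Deleting two equal edges leads to a family with `m - 2` edges, whose number is
known by the first stage. So a given pair of edges coincides with probability `O ((D / m) ^ k)`, and
all but a proportion `O (m² (D / m) ^ k)` of the families enumerate the edges of a hypergraph
(`card_edgeSeqs_le_add_card_injective`, `factorial_mul_card_kGraphs`).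

*Comparison.* By Vandermonde's identity the conditioned binomial law is an explicit quotient of
binomial coefficients (`probB_natCast`). Its quotient by `configWeight / (C(n, k))_m` is a quotient
of falling factorials, which equals `exp (-(k - 1) k m / (2 n))` up to small errors
(`weightRatio_bounds`), and `λ` plus the exponent in the claim is exactly `(k - 1) k m / (2 n)`
(`exponent_add_loopMean`).

Both error terms `k D² / m` and `k m² (D / m) ^ k` are `O (ψ)` (`sizes_of_psi_lt_one`), which is
better than the `O (√ψ)` that is claimed.
-/

set_option linter.unusedSectionVars false

namespace SparseHypergraph

/-! ### Families of edges and exchanges of two incidences -/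

section Sequences

variable {ι V : Type*} [Fintype ι] [DecidableEq ι] [Fintype V] [DecidableEq V]

/-- The families `F` of `k`-element subsets of `V`, indexed by `ι`, in which every `v : V` lies in
exactly `d v` members. Members may coincide, so these are ordered multi-hypergraphs without
repeated vertices inside an edge; equivalently, `0`-`1` matrices with prescribed row and column
sums. -/
def edgeSeqs (ι : Type*) {V : Type*} [Fintype ι] [DecidableEq ι] [Fintype V] [DecidableEq V]
    (k : ℕ) (d : V → ℕ) : Finset (ι → Finset V) :=
  {F | (∀ i, (F i).card = k) ∧ ∀ v, (Finset.univ.filter fun i => v ∈ F i).card = d v}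

theorem mem_edgeSeqs {k : ℕ} {d : V → ℕ} {F : ι → Finset V} :
    F ∈ edgeSeqs ι k d ↔
      (∀ i, (F i).card = k) ∧ ∀ v, (Finset.univ.filter fun i => v ∈ F i).card = d v := by
  simp [edgeSeqs]

theorem card_filter_prod {X Y : Type*} [Fintype X] [Fintype Y] (p : X × Y → Prop)
    [DecidablePred p] :
    (Finset.univ.filter p).card = ∑ x, (Finset.univ.filter fun y => p (x, y)).card := by
  simp only [Finset.card_filter, Fintype.sum_prod_type]

/-- The family obtained from `F` by exchanging the vertices `b` and `v` in the members `F i` and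
`F j`. -/
def exchange (F : ι → Finset V) (b v : V) (i j : ι) : ι → Finset V := fun l =>
  if l = i ∨ l = j then (F l).map (Equiv.swap b v).toEmbedding else F l

/-- The data of an admissible exchange: `b` lies in the `i`-th but not the `j`-th member, and `v`
lies in the `j`-th but not the `i`-th. The data are grouped as `((F, i), (j, v))`. -/
def IsExchange (b : V) (t : ((ι → Finset V) × ι) × (ι × V)) : Prop :=
  b ∈ t.1.1 t.1.2 ∧ b ∉ t.1.1 t.2.1 ∧ t.2.2 ∈ t.1.1 t.2.1 ∧ t.2.2 ∉ t.1.1 t.1.2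

instance (b : V) : DecidablePred (IsExchange (ι := ι) b) := fun t => by
  unfold IsExchange; infer_instance

/-- Performing an exchange; the roles of `i` and `j` are reversed afterwards. -/
def applyExchange (b : V) (t : ((ι → Finset V) × ι) × (ι × V)) :
    ((ι → Finset V) × ι) × (ι × V) :=
  ((exchange t.1.1 b t.2.2 t.1.2 t.2.1, t.2.1), (t.1.2, t.2.2))

theorem mem_exchange {F : ι → Finset V} {b v x : V} {i j l : ι} :
    x ∈ exchange F b v i j l ↔
      (if l = i ∨ l = j then Equiv.swap b v x else x) ∈ F l := by
  unfold exchange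
  split_ifs <;> simp [Finset.mem_map_equiv]

theorem mem_exchange_of_ne {F : ι → Finset V} {b v x : V} {i j l : ι} (hb : x ≠ b) (hv : x ≠ v) :
    x ∈ exchange F b v i j l ↔ x ∈ F l := by
  rw [mem_exchange, Equiv.swap_apply_of_ne_of_ne hb hv, ite_self]

theorem card_exchange {F : ι → Finset V} {b v : V} {i j l : ι} :
    (exchange F b v i j l).card = (F l).card := by
  unfold exchange
  split_ifs <;> simp

theorem exchange_exchange (F : ι → Finset V) (b v : V) (i j : ι) :
    exchange (exchange F b v i j) b v j i = F := by
  funext l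
  ext x
  rw [mem_exchange, mem_exchange]
  by_cases h : l = i ∨ l = j
  · simp [h, h.symm]
  · have h' : ¬ (l = j ∨ l = i) := fun c => h c.symm
    simp [h, h']

theorem IsExchange.applyExchange {b : V} {t : ((ι → Finset V) × ι) × (ι × V)}
    (h : IsExchange b t) : IsExchange b (applyExchange b t) := by
  obtain ⟨⟨F, i⟩, j, v⟩ := t
  obtain ⟨h1, h2, h3, h4⟩ := h
  simp only [IsExchange, SparseHypergraph.applyExchange, mem_exchange]
  simp at h1 h2 h3 h4 ⊢
  exact ⟨h3, h4, h1, h2⟩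

theorem exchange_mem_edgeSeqs {k : ℕ} {d : V → ℕ} {b : V}
    {t : ((ι → Finset V) × ι) × (ι × V)} (h : IsExchange b t) (hF : t.1.1 ∈ edgeSeqs ι k d) :
    (applyExchange b t).1.1 ∈ edgeSeqs ι k d := by
  obtain ⟨⟨F, i⟩, j, v⟩ := t
  obtain ⟨h1, h2, h3, h4⟩ := h
  simp only at h1 h2 h3 h4 hF
  rw [mem_edgeSeqs] at hF ⊢
  refine ⟨fun l => by rw [applyExchange, card_exchange]; exact hF.1 l, fun x => ?_⟩
  rw [← hF.2 x]
  simp only [applyExchange]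
  by_cases hx : x = b ∨ x = v
  · -- the membership pattern of `b` and of `v` is permuted by the transposition of `i` and `j`
    refine Finset.card_equiv (Equiv.swap i j) fun l => ?_
    simp only [Finset.mem_filter, Finset.mem_univ, true_and, mem_exchange]
    by_cases hi : l = i
    · subst hi; rcases hx with rfl | rfl <;> simp [*]
    · by_cases hj : l = j
      · subst hj; rcases hx with rfl | rfl <;> simp [*]
      · simp [hi, hj, Equiv.swap_apply_of_ne_of_ne hi hj]
  · push Not at hx
    simp only [mem_exchange_of_ne hx.1 hx.2]

/-- Exchanging is an involution, so sums over the admissible exchanges are invariant. -/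
theorem sum_exchange {k : ℕ} {d : V → ℕ} (b : V) (φ : ((ι → Finset V) × ι) × (ι × V) → ℕ) :
    ∑ t with t.1.1 ∈ edgeSeqs ι k d ∧ IsExchange b t, φ t =
      ∑ t with t.1.1 ∈ edgeSeqs ι k d ∧ IsExchange b t, φ (applyExchange b t) := by
  symm
  refine Finset.sum_nbij' (applyExchange b) (applyExchange b) ?_ ?_ ?_ ?_ ?_
  · intro t ht
    simp only [Finset.mem_filter, Finset.mem_univ, true_and] at ht ⊢
    exact ⟨exchange_mem_edgeSeqs ht.2 ht.1, ht.2.applyExchange⟩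
  · intro t ht
    simp only [Finset.mem_filter, Finset.mem_univ, true_and] at ht ⊢
    exact ⟨exchange_mem_edgeSeqs ht.2 ht.1, ht.2.applyExchange⟩
  · intro t _
    simp [applyExchange, exchange_exchange]
  · intro t _
    simp [applyExchange, exchange_exchange]
  · intro t _; rfl

end Sequences

/-! ### Counting exchanges around a vertex of degree one -/

section Switching

variable {ι V : Type*} [Fintype ι] [DecidableEq ι] [Fintype V] [DecidableEq V]

/-- The families in `edgeSeqs ι k d` together with a marked member that contains `b`. -/
def pointed (ι : Type*) {V : Type*} [Fintype ι] [DecidableEq ι] [Fintype V] [DecidableEq V]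
    (k : ℕ) (d : V → ℕ) (b : V) : Finset ((ι → Finset V) × ι) :=
  {x | x.1 ∈ edgeSeqs ι k d ∧ b ∈ x.1 x.2}

theorem mem_pointed {k : ℕ} {d : V → ℕ} {b : V} {x : (ι → Finset V) × ι} :
    x ∈ pointed ι k d b ↔ x.1 ∈ edgeSeqs ι k d ∧ b ∈ x.1 x.2 := by
  simp [pointed]

theorem card_pointed (k : ℕ) (d : V → ℕ) (b : V) :
    (pointed ι k d b).card = d b * (edgeSeqs ι k d).card := by
  rw [pointed, card_filter_prod]
  have : ∀ F : ι → Finset V,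
      (Finset.univ.filter fun i => F ∈ edgeSeqs ι k d ∧ b ∈ F i).card =
        if F ∈ edgeSeqs ι k d then d b else 0 := by
    intro F
    split_ifs with h
    · simpa [h] using (mem_edgeSeqs.1 h).2 b
    · simp [h]
  simp only [this]
  rw [← Finset.sum_filter]
  simp [mul_comm]

theorem card_pointed_of_degree_eq_one {k : ℕ} {d : V → ℕ} {b : V} (hb : d b = 1) :
    (pointed ι k d b).card = (edgeSeqs ι k d).card := by
  rw [card_pointed, hb, one_mul]

theorem card_incidences {k : ℕ} {d : V → ℕ} {F : ι → Finset V} (hF : F ∈ edgeSeqs ι k d) :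
    (Finset.univ.filter fun y : ι × V => y.2 ∈ F y.1).card = k * Fintype.card ι := by
  rw [card_filter_prod]
  simp [(mem_edgeSeqs.1 hF).1, mul_comm]

theorem card_incidences_mem {k : ℕ} {d : V → ℕ} {F : ι → Finset V} (hF : F ∈ edgeSeqs ι k d)
    (s : Finset V) :
    (Finset.univ.filter fun y : ι × V => y.2 ∈ F y.1 ∧ y.2 ∈ s).card = ∑ v ∈ s, d v := by
  rw [card_filter_prod]
  simp only [Finset.card_filter]
  rw [Finset.sum_comm, ← Finset.sum_filter_add_sum_filter_not Finset.univ (· ∈ s)]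
  simp only [Finset.filter_univ_mem]
  have h1 : ∑ v with v ∉ s, ∑ i, (if v ∈ F i ∧ v ∈ s then 1 else 0) = 0 := by
    refine Finset.sum_eq_zero fun v hv => ?_
    simp only [Finset.mem_filter] at hv
    simp [hv.2]
  rw [h1, add_zero]
  refine Finset.sum_congr rfl fun v hv => ?_
  simp only [hv, and_true]
  rw [← Finset.card_filter]
  exact (mem_edgeSeqs.1 hF).2 v

theorem card_neighbours {k : ℕ} {d : V → ℕ} {F : ι → Finset V} (hF : F ∈ edgeSeqs ι k d)
    (a : V) :
    (Finset.univ.filter fun y : ι × V => a ∈ F y.1 ∧ y.2 ∈ F y.1 ∧ y.2 ≠ a).card =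
      d a * (k - 1) := by
  rw [card_filter_prod]
  have : ∀ j : ι, (Finset.univ.filter fun v => a ∈ F j ∧ v ∈ F j ∧ v ≠ a).card =
      if a ∈ F j then k - 1 else 0 := by
    intro j
    split_ifs with h
    · have : (Finset.univ.filter fun v => a ∈ F j ∧ v ∈ F j ∧ v ≠ a) = (F j).erase a := by
        ext v; simp [h, and_comm]
      rw [this, Finset.card_erase_of_mem h, (mem_edgeSeqs.1 hF).1]
    · simp [h]
  simp only [this]
  rw [← Finset.sum_filter, Finset.sum_const, (mem_edgeSeqs.1 hF).2, smul_eq_mul]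

theorem eq_of_mem_of_degree_eq_one {k : ℕ} {d : V → ℕ} {b : V} {F : ι → Finset V} {i j : ι}
    (hF : F ∈ edgeSeqs ι k d) (hb : d b = 1) (hi : b ∈ F i) (hj : b ∈ F j) : i = j := by
  have h := (mem_edgeSeqs.1 hF).2 b
  rw [hb, Finset.card_eq_one] at h
  obtain ⟨l, hl⟩ := h
  have h1 : i ∈ ({l} : Finset ι) := by rw [← hl]; simpa using hi
  have h2 : j ∈ ({l} : Finset ι) := by rw [← hl]; simpa using hj
  simp at h1 h2
  rw [h1, h2]

theorem isExchange_iff {k : ℕ} {d : V → ℕ} {b : V} {x : (ι → Finset V) × ι} {y : ι × V}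
    (hx : x ∈ pointed ι k d b) (hb : d b = 1) :
    IsExchange b (x, y) ↔ y.2 ∈ x.1 y.1 ∧ y.2 ∉ x.1 x.2 := by
  rw [mem_pointed] at hx
  refine ⟨fun h => ⟨h.2.2.1, h.2.2.2⟩, fun h => ⟨hx.2, fun hj => ?_, h.1, h.2⟩⟩
  have := eq_of_mem_of_degree_eq_one hx.1 hb hx.2 hj
  exact h.2 (this ▸ h.1)

theorem sum_exchange_pointed {k : ℕ} {d : V → ℕ} (b : V)
    (φ : ((ι → Finset V) × ι) × (ι × V) → ℕ) :
    ∑ t with t.1.1 ∈ edgeSeqs ι k d ∧ IsExchange b t, φ t =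
      ∑ x ∈ pointed ι k d b, ∑ y with IsExchange b (x, y), φ (x, y) := by
  rw [Finset.sum_filter, Fintype.sum_prod_type, pointed, Finset.sum_filter]
  refine Finset.sum_congr rfl fun x _ => ?_
  split_ifs with h
  · simp [h.1, Finset.sum_filter]
  · refine Finset.sum_eq_zero fun y _ => if_neg fun c => h ⟨c.1, c.2.1⟩

/-- All but at most `k * D` of the incidences can be exchanged with the incidence of `b`. -/
theorem card_isExchange_ge {k D : ℕ} {d : V → ℕ} {b : V} {x : (ι → Finset V) × ι}
    (hx : x ∈ pointed ι k d b) (hb : d b = 1) (hD : ∀ v, d v ≤ D) :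
    k * Fintype.card ι ≤ (Finset.univ.filter fun y => IsExchange b (x, y)).card + k * D := by
  have hF := (mem_pointed.1 hx).1
  have h1 : (Finset.univ.filter fun y : ι × V => y.2 ∈ x.1 y.1 ∧ y.2 ∈ x.1 x.2).card ≤ k * D := by
    rw [card_incidences_mem hF]
    refine (Finset.sum_le_card_nsmul _ _ D fun v _ => hD v).trans ?_
    rw [(mem_edgeSeqs.1 hF).1, smul_eq_mul]
  rw [← card_incidences hF,
    ← Finset.card_filter_add_card_filter_not (s := Finset.univ.filter fun y : ι × V => y.2 ∈ x.1 y.1)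
      (fun y => y.2 ∈ x.1 x.2), Finset.filter_filter, Finset.filter_filter]
  simp only [isExchange_iff hx hb]
  omega

theorem card_isExchange_le {k : ℕ} {d : V → ℕ} {b : V} {x : (ι → Finset V) × ι}
    (hx : x ∈ pointed ι k d b) :
    (Finset.univ.filter fun y => IsExchange b (x, y)).card ≤ k * Fintype.card ι := by
  rw [← card_incidences (mem_pointed.1 hx).1]
  exact Finset.card_le_card fun y hy => by
    simp only [Finset.mem_filter, Finset.mem_univ, true_and] at hy ⊢
    exact hy.2.2.1

/-- Exchanging `b` moves it into a uniformly random position: the families in which `a` and `b`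
share a member correspond to exchanges with a vertex that shares a member with `a`. -/
theorem sum_isExchange_adjacent {k : ℕ} {d : V → ℕ} {a b : V} (hab : a ≠ b) :
    ∑ x ∈ pointed ι k d b with a ∈ x.1 x.2, (Finset.univ.filter fun y => IsExchange b (x, y)).card =
      ∑ x ∈ pointed ι k d b,
        (Finset.univ.filter fun y => IsExchange b (x, y) ∧ a ∈ x.1 y.1 ∧ y.2 ≠ a).card := by
  have h := sum_exchange (ι := ι) (k := k) (d := d) b
    (fun t => if a ∈ t.1.1 t.1.2 then 1 else 0)
  rw [sum_exchange_pointed, sum_exchange_pointed] at h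
  rw [Finset.sum_filter]
  convert h using 2 with x hx x hx
  · split_ifs <;> simp
  · rw [← Finset.sum_filter, Finset.filter_filter, Finset.card_eq_sum_ones]
    refine Finset.sum_congr (Finset.filter_congr fun y _ => and_congr_right fun hy => ?_)
      fun _ _ => rfl
    obtain ⟨F, i⟩ := x
    obtain ⟨j, v⟩ := y
    obtain ⟨h1, h2, h3, h4⟩ := hy
    simp only [applyExchange, mem_exchange, or_true, if_true] at h1 h2 h3 h4 ⊢
    by_cases hv : v = a
    · subst hv; simp [h2]
    · rw [Equiv.swap_apply_of_ne_of_ne hab (Ne.symm hv)]; simp [hv]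

/-- Upper bound for the number of families in which `a` and `b` share a member. -/
theorem card_adjacent_mul_le {k D : ℕ} {d : V → ℕ} {a b : V} (hab : a ≠ b) (hb : d b = 1)
    (hD : ∀ v, d v ≤ D) :
    ((pointed ι k d b).filter fun x => a ∈ x.1 x.2).card * (k * Fintype.card ι) ≤
      (edgeSeqs ι k d).card * (d a * (k - 1)) +
        ((pointed ι k d b).filter fun x => a ∈ x.1 x.2).card * (k * D) := by
  have h1 : ∑ x ∈ pointed ι k d b,
        (Finset.univ.filter fun y => IsExchange b (x, y) ∧ a ∈ x.1 y.1 ∧ y.2 ≠ a).card ≤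
      (edgeSeqs ι k d).card * (d a * (k - 1)) := by
    rw [← card_pointed_of_degree_eq_one hb, ← smul_eq_mul]
    refine Finset.sum_le_card_nsmul _ _ _ fun x hx => ?_
    rw [← card_neighbours (mem_pointed.1 hx).1]
    refine Finset.card_le_card fun y hy => ?_
    simp only [Finset.mem_filter, Finset.mem_univ, true_and] at hy ⊢
    exact ⟨hy.2.1, hy.1.2.2.1, hy.2.2⟩
  rw [← sum_isExchange_adjacent hab] at h1
  refine le_trans ?_ (Nat.add_le_add_right h1 _)
  rw [← smul_eq_mul, ← smul_eq_mul (_ : ℕ) (k * D), ← Finset.sum_const, ← Finset.sum_const,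
    ← Finset.sum_add_distrib]
  exact Finset.sum_le_sum fun x hx => card_isExchange_ge (Finset.mem_filter.1 hx).1 hb hD

/-- The incidences `(j, v)` such that `v` lies both in the marked member and in a different member
together with `a`. -/
def obstructions (a : V) (x : (ι → Finset V) × ι) : Finset (ι × V) :=
  {y | y.1 ≠ x.2 ∧ a ∈ x.1 y.1 ∧ y.2 ∈ x.1 y.1 ∧ y.2 ≠ a ∧ y.2 ∈ x.1 x.2}

/-- Lower bound for the number of families in which `a` and `b` share a member: an incidence `(j, v)`
with `v` adjacent to `a` fails to be an exchange only if `j` is the marked member or `(j, v)` is an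
obstruction. -/
theorem le_card_adjacent_mul {k : ℕ} {d : V → ℕ} {a b : V} (hab : a ≠ b) (hb : d b = 1) :
    (edgeSeqs ι k d).card * (d a * (k - 1)) ≤
      ((pointed ι k d b).filter fun x => a ∈ x.1 x.2).card * (k * Fintype.card ι + k) +
        ∑ x ∈ pointed ι k d b, (obstructions a x).card := by
  have h1 : (edgeSeqs ι k d).card * (d a * (k - 1)) ≤
      ∑ x ∈ pointed ι k d b,
        ((Finset.univ.filter fun y => IsExchange b (x, y) ∧ a ∈ x.1 y.1 ∧ y.2 ≠ a).card
          + ((if a ∈ x.1 x.2 then k else 0) + (obstructions a x).card)) := by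
    rw [← card_pointed_of_degree_eq_one hb, ← smul_eq_mul]
    refine Finset.card_nsmul_le_sum _ _ _ fun x hx => ?_
    have hF := (mem_pointed.1 hx).1
    rw [← card_neighbours hF]
    have h2 : (Finset.univ.filter fun y : ι × V => y.1 = x.2 ∧ a ∈ x.1 x.2 ∧ y.2 ∈ x.1 x.2).card ≤
        if a ∈ x.1 x.2 then k else 0 := by
      split_ifs with h
      · rw [← (mem_edgeSeqs.1 hF).1 x.2]
        refine Finset.card_le_card_of_injOn Prod.snd ?_ ?_
        · intro y hy
          simp only [Finset.coe_filter, Finset.mem_univ, true_and, Set.mem_ofPred_eq] at hy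
          exact hy.2.2
        · intro y hy z hz hyz
          simp only [Finset.coe_filter, Finset.mem_univ, true_and, Set.mem_ofPred_eq] at hy hz
          exact Prod.ext (hy.1.trans hz.1.symm) hyz
      · simp [h]
    refine le_trans ?_ (Nat.add_le_add_left (Nat.add_le_add_right h2 _) _)
    refine le_trans ?_ (Nat.add_le_add_left (Finset.card_union_le _ _) _)
    refine le_trans ?_ (Finset.card_union_le _ _)
    refine Finset.card_le_card fun y hy => ?_
    simp only [Finset.mem_filter, Finset.mem_univ, true_and, Finset.mem_union, obstructions,
      isExchange_iff hx hb] at hy ⊢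
    obtain ⟨h3, h4, h5⟩ := hy
    by_cases h6 : y.2 ∈ x.1 x.2
    · by_cases h7 : y.1 = x.2
      · exact Or.inr (Or.inl ⟨h7, h7 ▸ h3, h6⟩)
      · exact Or.inr (Or.inr ⟨h7, h3, h4, h5, h6⟩)
    · exact Or.inl ⟨⟨h4, h6⟩, h3, h5⟩
  rw [Finset.sum_add_distrib, Finset.sum_add_distrib, ← sum_isExchange_adjacent hab,
    ← Finset.sum_filter, ← add_assoc, Finset.sum_const, smul_eq_mul] at h1
  refine h1.trans (Nat.add_le_add_right ?_ _)
  rw [mul_add]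
  refine Nat.add_le_add_right ?_ _
  rw [← smul_eq_mul]
  exact Finset.sum_le_card_nsmul _ _ _ fun x hx => card_isExchange_le (Finset.mem_filter.1 hx).1

/-- A second exchange shows that few families have an obstruction: moving `b` elsewhere turns an
obstruction into a pair of members that share a vertex `v` adjacent to `a`, together with one of
the `k` vertices of the second member. -/
theorem sum_obstructions_mul_le {k D : ℕ} {d : V → ℕ} {a b : V} (hab : a ≠ b) (hb : d b = 1)
    (hD : ∀ v, d v ≤ D) :
    (∑ x ∈ pointed ι k d b, (obstructions a x).card) * (k * Fintype.card ι) ≤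
      (edgeSeqs ι k d).card * (d a * (k - 1) * (D * k)) +
        (∑ x ∈ pointed ι k d b, (obstructions a x).card) * (k * D + D) := by
  have h := sum_exchange (ι := ι) (k := k) (d := d) b
    (fun t => if t.2.2 ≠ a then (obstructions a t.1).card else 0)
  rw [sum_exchange_pointed, sum_exchange_pointed] at h
  have hlow : (∑ x ∈ pointed ι k d b, (obstructions a x).card) * (k * Fintype.card ι) ≤
      ∑ x ∈ pointed ι k d b, ∑ y with IsExchange b (x, y),
        (if y.2 ≠ a then (obstructions a x).card else 0) +
      (∑ x ∈ pointed ι k d b, (obstructions a x).card) * (k * D + D) := by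
    rw [Finset.sum_mul, Finset.sum_mul, ← Finset.sum_add_distrib]
    refine Finset.sum_le_sum fun x hx => ?_
    have hF := (mem_pointed.1 hx).1
    rw [← Finset.sum_filter, Finset.sum_const, smul_eq_mul, mul_comm _ (obstructions a x).card,
      ← mul_add, Finset.filter_filter]
    refine Nat.mul_le_mul_left _ ?_
    have h1 := card_isExchange_ge hx hb hD
    have h2 : (Finset.univ.filter fun y => IsExchange b (x, y)).card ≤
        (Finset.univ.filter fun y : ι × V => IsExchange b (x, y) ∧ y.2 ≠ a).card +
          (Finset.univ.filter fun y : ι × V => y.2 ∈ x.1 y.1 ∧ y.2 ∈ ({a} : Finset V)).card := by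
      refine le_trans (Finset.card_le_card fun y hy => ?_) (Finset.card_union_le _ _)
      simp only [Finset.mem_filter, Finset.mem_univ, true_and, Finset.mem_union,
        Finset.mem_singleton] at hy ⊢
      by_cases h3 : y.2 = a
      · exact Or.inr ⟨hy.2.2.1, h3⟩
      · exact Or.inl ⟨hy, h3⟩
    rw [card_incidences_mem hF, Finset.sum_singleton] at h2
    have := hD a
    omega
  refine hlow.trans (Nat.add_le_add_right ?_ _)
  simp only at h
  rw [h]
  have hup : ∀ x ∈ pointed ι k d b, (∑ y with IsExchange b (x, y),
      (if (applyExchange b (x, y)).2.2 ≠ a then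
        (obstructions a (applyExchange b (x, y)).1).card else 0)) ≤
      d a * (k - 1) * (D * k) := by
    intro x hx
    have hF := (mem_pointed.1 hx).1
    obtain ⟨F, i⟩ := x
    calc _ ≤ ∑ y : ι × V with y.2 ∈ F y.1,
          (Finset.univ.filter fun z : ι × V =>
            (a ∈ F z.1 ∧ z.2 ∈ F z.1 ∧ z.2 ≠ a) ∧ z.2 ∈ F y.1).card := by
          refine (Finset.sum_le_sum (g := fun y : ι × V => (Finset.univ.filter fun z : ι × V =>
            (a ∈ F z.1 ∧ z.2 ∈ F z.1 ∧ z.2 ≠ a) ∧ z.2 ∈ F y.1).card) fun y hy => ?_).trans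
            (Finset.sum_le_sum_of_subset fun y hy => ?_)
          · obtain ⟨l, u⟩ := y
            simp only [Finset.mem_filter, Finset.mem_univ, true_and] at hy
            split_ifs with hu
            · refine Finset.card_le_card fun z hz => ?_
              obtain ⟨j, v⟩ := z
              have hex := hy.applyExchange
              have hF' := exchange_mem_edgeSeqs hy hF
              simp only [applyExchange] at hu hz hex hF'
              simp only [obstructions, Finset.mem_filter, Finset.mem_univ, true_and] at hz ⊢
              obtain ⟨h1, h2, h3, h4, h5⟩ := hz
              obtain ⟨e1, e2, e3, e4⟩ := hex
              simp only at e1 e2 e3 e4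
              -- `v` is neither `b`, which has degree one, nor `u`, which has left the member `l`
              have hvb : v ≠ b := by
                rintro rfl
                exact h1 (eq_of_mem_of_degree_eq_one hF' hb h3 e1)
              have hvu : v ≠ u := by
                rintro rfl
                exact e4 h5
              rw [mem_exchange_of_ne hab (Ne.symm hu)] at h2
              rw [mem_exchange_of_ne hvb hvu] at h3 h5
              exact ⟨⟨h2, h3, h4⟩, h5⟩
            · exact Nat.zero_le _
          · simp only [Finset.mem_filter, Finset.mem_univ, true_and] at hy ⊢
            exact hy.2.2.1
      _ = ∑ z : ι × V with (a ∈ F z.1 ∧ z.2 ∈ F z.1 ∧ z.2 ≠ a),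
            (Finset.univ.filter fun y : ι × V => z.2 ∈ F y.1 ∧ y.2 ∈ F y.1).card := by
          simp only [Finset.card_filter, Finset.sum_filter]
          simp only [← Finset.sum_filter]
          simp only [Finset.sum_filter]
          have e1 : ∀ y : ι × V, (if y.2 ∈ F y.1 then ∑ z : ι × V,
              (if (a ∈ F z.1 ∧ z.2 ∈ F z.1 ∧ z.2 ≠ a) ∧ z.2 ∈ F y.1 then 1 else 0) else 0) =
              ∑ z : ι × V, if (a ∈ F z.1 ∧ z.2 ∈ F z.1 ∧ z.2 ≠ a) then
                (if z.2 ∈ F y.1 ∧ y.2 ∈ F y.1 then 1 else 0) else 0 := by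
            intro y
            by_cases hy : y.2 ∈ F y.1 <;> simp [hy, ite_and]
          simp only [e1]
          rw [Finset.sum_comm]
          refine Finset.sum_congr rfl fun z _ => ?_
          split_ifs <;> simp
      _ ≤ d a * (k - 1) * (D * k) := by
          rw [← card_neighbours hF, ← smul_eq_mul]
          refine Finset.sum_le_card_nsmul _ _ _ fun z _ => ?_
          rw [card_filter_prod]
          have e2 : ∀ l : ι, (Finset.univ.filter fun v => z.2 ∈ F l ∧ v ∈ F l).card =
              if z.2 ∈ F l then k else 0 := by
            intro l
            split_ifs with hl
            · simp [hl, (mem_edgeSeqs.1 hF).1]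
            · simp [hl]
          simp only [e2]
          rw [← Finset.sum_filter, Finset.sum_const, (mem_edgeSeqs.1 hF).2, smul_eq_mul]
          exact Nat.mul_le_mul_right _ (hD _)
  refine (Finset.sum_le_card_nsmul _ _ _ hup).trans ?_
  rw [card_pointed_of_degree_eq_one hb, smul_eq_mul]

end Switching

/-! ### Splitting a vertex -/

section Splitting

variable {ι V : Type*} [Fintype ι] [DecidableEq ι] [Fintype V] [DecidableEq V]

/-- The family obtained from `F` by exchanging the vertices `a` and `b` in the member `F i`. -/
def relabel (F : ι → Finset V) (a b : V) (i : ι) : ι → Finset V := fun l =>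
  if l = i then (F l).map (Equiv.swap a b).toEmbedding else F l

theorem mem_relabel {F : ι → Finset V} {a b x : V} {i l : ι} :
    x ∈ relabel F a b i l ↔ (if l = i then Equiv.swap a b x else x) ∈ F l := by
  unfold relabel
  split_ifs <;> simp [Finset.mem_map_equiv]

theorem relabel_relabel (F : ι → Finset V) (a b : V) (i : ι) :
    relabel (relabel F a b i) b a i = F := by
  funext l
  ext x
  rw [mem_relabel, mem_relabel]
  by_cases h : l = i <;> simp [h, Equiv.swap_comm a b]

theorem relabel_mem_edgeSeqs {k : ℕ} {d d' : V → ℕ} {a b : V} {F : ι → Finset V} {i : ι}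
    (hF : F ∈ edgeSeqs ι k d) (ha : a ∈ F i) (hb : b ∉ F i) (hda : d' a + 1 = d a)
    (hdb : d' b = d b + 1) (hd : ∀ v, v ≠ a → v ≠ b → d' v = d v) :
    relabel F a b i ∈ edgeSeqs ι k d' := by
  have hab : a ≠ b := fun h => hb (h ▸ ha)
  rw [mem_edgeSeqs] at hF ⊢
  refine ⟨fun l => ?_, fun v => ?_⟩
  · rw [← hF.1 l]
    unfold relabel
    split_ifs <;> simp
  · by_cases hva : v = a
    · subst hva
      have : (Finset.univ.filter fun l => v ∈ relabel F v b i l) =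
          (Finset.univ.filter fun l => v ∈ F l).erase i := by
        ext l
        by_cases h : l = i
        · subst h; simp [mem_relabel, hb]
        · simp [mem_relabel, h]
      rw [this, Finset.card_erase_of_mem (by simpa using ha), hF.2, ← hda, Nat.add_sub_cancel]
    · by_cases hvb : v = b
      · subst hvb
        have : (Finset.univ.filter fun l => v ∈ relabel F a v i l) =
            insert i (Finset.univ.filter fun l => v ∈ F l) := by
          ext l
          by_cases h : l = i
          · subst h; simp [mem_relabel, ha]
          · simp [mem_relabel, h]
        rw [this, Finset.card_insert_of_notMem (by simpa using hb), hF.2, hdb]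
      · simp only [mem_relabel, Equiv.swap_apply_of_ne_of_ne hva hvb, ite_self]
        rw [hF.2, hd v hva hvb]

/-- Splitting one incidence off the vertex `a` and giving it to the isolated vertex `b`. -/
theorem degree_mul_card_edgeSeqs {k : ℕ} {d d' : V → ℕ} {a b : V}
    (hda : d' a + 1 = d a) (hb : d b = 0) (hdb : d' b = 1)
    (hd : ∀ v, v ≠ a → v ≠ b → d' v = d v) :
    d a * (edgeSeqs ι k d).card + ((pointed ι k d' b).filter fun x => a ∈ x.1 x.2).card =
      (edgeSeqs ι k d').card := by
  rw [← card_pointed_of_degree_eq_one hdb, ← card_pointed,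
    ← Finset.card_filter_add_card_filter_not (s := pointed ι k d' b) (fun x => a ∈ x.1 x.2),
    add_comm]
  congr 1
  refine Finset.card_nbij' (fun x => (relabel x.1 a b x.2, x.2))
    (fun x => (relabel x.1 b a x.2, x.2)) ?_ ?_ ?_ ?_
  · intro x hx
    simp only [Finset.mem_coe, mem_pointed, Finset.mem_filter] at hx ⊢
    have hbx : b ∉ x.1 x.2 := fun h => by
      have := (mem_edgeSeqs.1 hx.1).2 b
      rw [hb, Finset.card_eq_zero] at this
      exact Finset.notMem_empty x.2 (this ▸ by simpa using h)
    refine ⟨⟨relabel_mem_edgeSeqs hx.1 hx.2 hbx hda (by rw [hdb, hb]) hd, ?_⟩, ?_⟩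
    · simp [mem_relabel, hx.2]
    · simp [mem_relabel, hbx]
  · intro x hx
    simp only [Finset.mem_coe, mem_pointed, Finset.mem_filter] at hx ⊢
    refine ⟨relabel_mem_edgeSeqs hx.1.1 hx.1.2 hx.2 (by rw [hdb, hb]) hda.symm
      fun v h1 h2 => (hd v h2 h1).symm, ?_⟩
    simp [mem_relabel, hx.1.2]
  · intro x _
    simp [relabel_relabel]
  · intro x _
    simp [relabel_relabel]

/-- If `p` is `x` up to relative errors `O(δ)`, then so is `-log (1 - p)`. In the application `p` is the
proportion of families in which two vertices share a member, and `o` is the average number of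
obstructions divided by the number of incidences. -/
theorem exp_bounds_of_selfbound {x δ p o : ℝ} (hx : 0 ≤ x) (hxδ : x ≤ δ) (hδ : δ ≤ 1 / 16)
    (hp : 0 ≤ p) (h1 : p ≤ x + p * δ) (h2 : x ≤ p * (1 + δ) + o) (h3 : o ≤ x * δ + o * (2 * δ)) :
    Real.exp (-(x * (1 + 8 * δ))) ≤ 1 - p ∧ 1 - p ≤ Real.exp (-(x * (1 - 8 * δ))) := by
  have hδ0 : 0 ≤ δ := hx.trans hxδ
  have hxd : 0 ≤ x * δ := mul_nonneg hx hδ0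
  have hxd2 : x * δ * δ ≤ x * δ * (1 / 16) := mul_le_mul_of_nonneg_left hδ hxd
  have ho : o ≤ 2 * (x * δ) := by
    by_contra! h
    nlinarith
  have hpx : p ≤ x * (1 + 2 * δ) := by
    by_contra! h
    nlinarith
  have hpl : x * (1 - 8 * δ) ≤ p := by
    by_contra! h
    nlinarith
  refine ⟨?_, (Real.one_sub_le_exp_neg p).trans (Real.exp_le_exp.2 (neg_le_neg hpl))⟩
  set q := x * (1 + 8 * δ) with hq
  have hq0 : 0 ≤ q := by positivity
  have hqx : q ≤ 3 / 2 * x := by nlinarith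
  have hpq : p * (1 + q) ≤ q := by
    have e1 : p * q ≤ x * (1 + 2 * δ) * (3 / 2 * δ) := by
      apply mul_le_mul hpx (by linarith) hq0 (by positivity)
    nlinarith
  rw [Real.exp_neg, inv_le_comm₀ (Real.exp_pos _) (by nlinarith)]
  refine le_trans ?_ (Real.add_one_le_exp q)
  rw [inv_le_iff_one_le_mul₀ (by nlinarith)]
  nlinarith

/-- The three counting inequalities for exchanges, divided by the number of families. -/
theorem sub_bounds_of_switching {A B O k m D α : ℝ} (hA : 0 < A) (hB : 0 ≤ B)
    (hk : 1 ≤ k) (hm : 1 ≤ m) (hD : 1 ≤ D) (hα : 0 ≤ α) (hαD : α ≤ D) (hDm : 16 * D ≤ m)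
    (r1 : B * (k * m) ≤ A * (α * (k - 1)) + B * (k * D))
    (r2 : A * (α * (k - 1)) ≤ B * (k * m + k) + O)
    (r3 : O * (k * m) ≤ A * (α * (k - 1) * (D * k)) + O * (k * D + D)) (hO : 0 ≤ O) :
    Real.exp (-(α * (k - 1) / (k * m) * (1 + 8 * (D / m)))) * A ≤ A - B ∧
      A - B ≤ Real.exp (-(α * (k - 1) / (k * m) * (1 - 8 * (D / m)))) * A := by
  have hM : 0 < k * m := by positivity
  have hδm : D / m * m = D := by field_simp
  have hxM : α * (k - 1) / (k * m) * (k * m) = α * (k - 1) := div_mul_cancel₀ _ hM.ne'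
  have hx0 : 0 ≤ α * (k - 1) / (k * m) :=
    div_nonneg (mul_nonneg hα (by linarith)) hM.le
  have hδ0 : 0 ≤ D / m := by positivity
  have hδ1 : D / m ≤ 1 / 16 := by
    rw [div_le_iff₀ (by positivity)]; linarith
  have hAM : 0 < A * (k * m) := by positivity
  have hp : B / A * A = B := div_mul_cancel₀ _ hA.ne'
  have ho : O / (A * (k * m)) * (A * (k * m)) = O := div_mul_cancel₀ _ hAM.ne'
  have hp0 : 0 ≤ B / A := by positivity
  generalize α * (k - 1) / (k * m) = x at *
  generalize D / m = δ at *
  generalize B / A = p at *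
  generalize O / (A * (k * m)) = o at *
  have key := exp_bounds_of_selfbound (x := x) (δ := δ) (p := p) (o := o) hx0 ?_ hδ1 hp0 ?_ ?_ ?_
  · have e : A - B = (1 - p) * A := by rw [sub_mul, hp, one_mul]
    rw [e]
    exact ⟨mul_le_mul_of_nonneg_right key.1 hA.le, mul_le_mul_of_nonneg_right key.2 hA.le⟩
  · refine le_of_mul_le_mul_right ?_ hM
    rw [hxM, show δ * (k * m) = D * k by rw [← hδm]; ring]
    exact mul_le_mul hαD (by linarith) (by linarith) (by positivity)
  · refine le_of_mul_le_mul_right ?_ hAM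
    calc p * (A * (k * m)) = B * (k * m) := by rw [← hp]; ring
      _ ≤ A * (α * (k - 1)) + B * (k * D) := r1
      _ = (x + p * δ) * (A * (k * m)) := by rw [← hxM, ← hp, ← hδm]; ring
  · refine le_of_mul_le_mul_right ?_ hAM
    calc x * (A * (k * m)) = A * (α * (k - 1)) := by rw [← hxM]; ring
      _ ≤ B * (k * m + k) + O := r2
      _ ≤ B * (k * m + k * D) + O := by gcongr; nlinarith
      _ = (p * (1 + δ) + o) * (A * (k * m)) := by
        rw [add_mul, ho, ← hδm, ← hp]; ring
  · refine le_of_mul_le_mul_right ?_ hM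
    refine le_of_mul_le_mul_right ?_ hAM
    calc o * (k * m) * (A * (k * m)) = O * (k * m) := by rw [← ho]; ring
      _ ≤ A * (α * (k - 1) * (D * k)) + O * (k * D + D) := r3
      _ ≤ A * (α * (k - 1) * (D * k)) + O * (k * D + k * D) := by gcongr; nlinarith
      _ = (x * δ + o * (2 * δ)) * (k * m) * (A * (k * m)) := by
        rw [← hxM, ← hδm, ← ho]; ring

/-- The proportion of families in which the vertex `b` of degree one shares a member with `a`, in
exponential form. -/
theorem card_sub_card_adjacent_bounds {k D : ℕ} {d : V → ℕ} {a b : V} (hab : a ≠ b) (hb : d b = 1)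
    (hD : ∀ v, d v ≤ D) (hk : 1 ≤ k) (hm : 16 * D ≤ Fintype.card ι) :
    Real.exp (-((d a : ℝ) * (k - 1) / (k * Fintype.card ι) *
        (1 + 8 * ((D : ℝ) / Fintype.card ι)))) * (edgeSeqs ι k d).card ≤
        (edgeSeqs ι k d).card - ((pointed ι k d b).filter fun x => a ∈ x.1 x.2).card ∧
      ((edgeSeqs ι k d).card : ℝ) - ((pointed ι k d b).filter fun x => a ∈ x.1 x.2).card ≤
        Real.exp (-((d a : ℝ) * (k - 1) / (k * Fintype.card ι) *
          (1 - 8 * ((D : ℝ) / Fintype.card ι)))) * (edgeSeqs ι k d).card := by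
  have hD1 : 1 ≤ D := hb ▸ hD b
  have hm1 : 1 ≤ Fintype.card ι := by omega
  rcases Nat.eq_zero_or_pos (edgeSeqs ι k d).card with hA | hA
  · have hB0 : ((pointed ι k d b).filter fun x => a ∈ x.1 x.2).card = 0 := by
      rw [← Nat.le_zero, ← hA]
      exact (Finset.card_filter_le _ _).trans (card_pointed_of_degree_eq_one hb).le
    simp [hA, hB0]
  have hk1 : ((k - 1 : ℕ) : ℝ) = (k : ℝ) - 1 := by push_cast [hk]; ring
  refine sub_bounds_of_switching
    (O := ((∑ x ∈ pointed ι k d b, (obstructions a x).card : ℕ) : ℝ))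
    (by exact_mod_cast hA) (Nat.cast_nonneg _) (by exact_mod_cast hk) (by exact_mod_cast hm1)
    (by exact_mod_cast hD1) (Nat.cast_nonneg _) (by exact_mod_cast hD a) (by exact_mod_cast hm)
    ?_ ?_ ?_ (Nat.cast_nonneg _)
  · rw [← hk1]; exact_mod_cast card_adjacent_mul_le (ι := ι) (k := k) hab hb hD
  · rw [← hk1]; exact_mod_cast le_card_adjacent_mul (ι := ι) (k := k) hab hb
  · rw [← hk1]; exact_mod_cast sum_obstructions_mul_le (ι := ι) (k := k) hab hb hD

end Splitting

/-! ### Families with all degrees at most one -/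

section Base

variable {ι V : Type*} [Fintype ι] [DecidableEq ι] [Fintype V] [DecidableEq V]

theorem card_edgeSeqs_congr {κ : Type*} [Fintype κ] [DecidableEq κ] (e : ι ≃ κ) (k : ℕ)
    (d : V → ℕ) : (edgeSeqs ι k d).card = (edgeSeqs κ k d).card := by
  refine Finset.card_equiv (Equiv.arrowCongr e (Equiv.refl _)) fun F => ?_
  simp only [mem_edgeSeqs, Equiv.arrowCongr_apply, Equiv.coe_refl, Function.comp_apply, id_eq]
  refine and_congr ⟨fun h i => h _, fun h i => by simpa using h (e i)⟩
    (forall_congr' fun v => ?_)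
  rw [Finset.card_equiv (t := Finset.univ.filter fun i => v ∈ F (e.symm i)) e (by simp)]

theorem card_edgeSeqs_succ (m k : ℕ) (d : V → ℕ) :
    (edgeSeqs (Fin (m + 1)) k d).card =
      ∑ e ∈ (Finset.univ.filter fun v => 1 ≤ d v).powersetCard k,
        (edgeSeqs (Fin m) k fun v => d v - if v ∈ e then 1 else 0).card := by
  rw [← Finset.card_sigma]
  refine Finset.card_nbij' (fun F => ⟨F 0, Fin.tail F⟩) (fun x => Fin.cons x.1 x.2) ?_ ?_ ?_ ?_
  · intro F hF
    simp only [Finset.coe_sigma, Set.mem_sigma_iff, Finset.mem_coe, Finset.mem_powersetCard,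
      mem_edgeSeqs, Fin.card_filter_univ_succ] at hF ⊢
    refine ⟨⟨fun v hv => ?_, hF.1 0⟩, fun i => hF.1 _, fun v => ?_⟩
    · have := hF.2 v
      simp only [hv, if_true] at this
      simp only [Finset.mem_filter, Finset.mem_univ, true_and]
      omega
    · have := hF.2 v
      simp only [Fin.tail]
      rw [← this]
      split_ifs <;> simp <;> congr
  · rintro ⟨e, F⟩ h
    simp only [Finset.coe_sigma, Set.mem_sigma_iff, Finset.mem_coe, Finset.mem_powersetCard,
      mem_edgeSeqs, Fin.card_filter_univ_succ] at h ⊢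
    obtain ⟨⟨h1, h2⟩, h3, h4⟩ := h
    refine ⟨fun i => ?_, fun v => ?_⟩
    · cases i using Fin.cases with
      | zero => simpa using h2
      | succ i => simpa using h3 i
    · have h5 := h4 v
      simp only [Fin.cons_zero, Fin.cons_succ]
      split_ifs at h5 ⊢ with h6
      · have := h1 h6
        simp only [Finset.mem_filter, Finset.mem_univ, true_and] at this
        omega
      · omega
  · intro F _
    simp
  · rintro ⟨e, F⟩ _
    simp

theorem card_edgeSeqs_fin_of_degree_le_one {k m : ℕ} {d : V → ℕ} (hd : ∀ v, d v ≤ 1)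
    (hs : ∑ v, d v = k * m) :
    (edgeSeqs (Fin m) k d).card * k.factorial ^ m = (k * m).factorial := by
  induction m generalizing d with
  | zero =>
    have h0 : ∀ v, d v = 0 := fun v => by
      have := Finset.single_le_sum (f := d) (fun v _ => Nat.zero_le _) (Finset.mem_univ v)
      omega
    have : edgeSeqs (Fin 0) k d = Finset.univ := by
      ext F
      simp only [mem_edgeSeqs, h0, Finset.mem_univ, iff_true]
      exact ⟨fun i => i.elim0, fun v => by simp⟩
    simp [this]
  | succ m ih =>
    have hcard : (Finset.univ.filter fun v => 1 ≤ d v).card = k * (m + 1) := by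
      rw [← hs, Finset.card_filter]
      refine Finset.sum_congr rfl fun v _ => ?_
      have := hd v
      split_ifs <;> omega
    have hterm : ∀ e ∈ (Finset.univ.filter fun v => 1 ≤ d v).powersetCard k,
        (edgeSeqs (Fin m) k fun v => d v - if v ∈ e then 1 else 0).card * k.factorial ^ m =
          (k * m).factorial := by
      intro e he
      rw [Finset.mem_powersetCard] at he
      refine ih (fun v => (Nat.sub_le _ _).trans (hd v)) ?_
      rw [Finset.sum_tsub_distrib _ fun v _ => ?_, hs]
      · simp [he.2, mul_add]
      · split_ifs with hv
        · simpa using he.1 hv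
        · exact Nat.zero_le _
    rw [card_edgeSeqs_succ, pow_succ, ← mul_assoc, Finset.sum_mul, Finset.sum_congr rfl hterm,
      Finset.sum_const, Finset.card_powersetCard, hcard, smul_eq_mul]
    have := Nat.choose_mul_factorial_mul_factorial (n := k * (m + 1)) (k := k) (by nlinarith)
    rw [show k * (m + 1) - k = k * m by rw [mul_add, mul_one, Nat.add_sub_cancel]] at this
    rw [← this]
    ring

theorem card_edgeSeqs_of_degree_le_one {k : ℕ} {d : V → ℕ} (hd : ∀ v, d v ≤ 1)
    (hs : ∑ v, d v = k * Fintype.card ι) :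
    (edgeSeqs ι k d).card * k.factorial ^ Fintype.card ι = (k * Fintype.card ι).factorial := by
  rw [card_edgeSeqs_congr (Fintype.equivFin ι)]
  exact card_edgeSeqs_fin_of_degree_le_one hd hs

end Base

/-! ### The number of families with given degrees -/

section Count

variable {ι V : Type*} [Fintype ι] [DecidableEq ι] [Fintype V] [DecidableEq V]

/-- The expected number of pairs of points of a common vertex inside a common edge, when
`∑ v, d v = k * m` points, `d v` of them belonging to the vertex `v`, are randomly partitioned into
`m` edges of size `k`, up to the choice of the denominator `k * m` instead of `k * m - 1`. -/
noncomputable def loopMean (k m : ℕ) (d : V → ℕ) : ℝ :=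
  ((k : ℝ) - 1) * (∑ v, (d v : ℝ) * ((d v : ℝ) - 1)) / (2 * ((k : ℝ) * m))

/-- The number of ways to distribute `k * m` distinguishable points, `d v` of them belonging to the
vertex `v`, to a sequence of `m` edges of size `k`, divided by the number `∏ v, (d v)!` of
permutations of the points that preserve their vertices. A family in `edgeSeqs` corresponds to
exactly `∏ v, (d v)!` such distributions. -/
noncomputable def configWeight (k m : ℕ) (d : V → ℕ) : ℝ :=
  ((k * m).factorial : ℝ) / ((k.factorial : ℝ) ^ m * ∏ v, ((d v).factorial : ℝ))

theorem configWeight_pos (k m : ℕ) (d : V → ℕ) : 0 < configWeight k m d := by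
  unfold configWeight
  have : 0 < ∏ v, ((d v).factorial : ℝ) :=
    Finset.prod_pos fun v _ => by exact_mod_cast Nat.factorial_pos _
  have := Nat.factorial_pos (k * m)
  have := Nat.factorial_pos k
  positivity

theorem natCast_mul_sub_one_nonneg (x : ℕ) : 0 ≤ (x : ℝ) * ((x : ℝ) - 1) := by
  rcases Nat.eq_zero_or_pos x with h | h
  · simp [h]
  · have : (1 : ℝ) ≤ x := by exact_mod_cast h
    exact mul_nonneg (by linarith) (by linarith)

theorem loopMean_nonneg {k : ℕ} (hk : 1 ≤ k) (m : ℕ) (d : V → ℕ) : 0 ≤ loopMean k m d := by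
  unfold loopMean
  have hk' : (1 : ℝ) ≤ k := by exact_mod_cast hk
  exact div_nonneg (mul_nonneg (by linarith)
    (Finset.sum_nonneg fun v _ => natCast_mul_sub_one_nonneg _)) (by positivity)

@[to_additive]
theorem prod_mul_eq_of_eq_off_pair {M : Type*} [CommMonoid M] {a b : V} (hab : a ≠ b)
    {d d' : V → ℕ} (hd : ∀ v, v ≠ a → v ≠ b → d' v = d v) (f : ℕ → M) :
    (∏ v, f (d' v)) * (f (d a) * f (d b)) = (∏ v, f (d v)) * (f (d' a) * f (d' b)) := by
  have h : ∀ g : V → M, ∏ v, g v = g a * (g b * ∏ v ∈ (Finset.univ.erase a).erase b, g v) := by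
    intro g
    rw [Finset.mul_prod_erase _ _ (Finset.mem_erase.2 ⟨hab.symm, Finset.mem_univ b⟩),
      Finset.mul_prod_erase _ _ (Finset.mem_univ a)]
  have hrest : ∏ v ∈ (Finset.univ.erase a).erase b, f (d' v) =
      ∏ v ∈ (Finset.univ.erase a).erase b, f (d v) :=
    Finset.prod_congr rfl fun v hv => by
      simp only [Finset.mem_erase] at hv
      rw [hd v hv.2.1 hv.1]
  rw [h fun v => f (d' v), h fun v => f (d v), hrest]
  ac_rfl

/-- The count of families with given degrees, by induction on `∑ v, d v * (d v - 1)`: splitting one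
incidence off a vertex of degree at least two and moving it to an isolated vertex changes the count
by a factor that is known up to a relative error `D / m` in the exponent. There is always an
isolated vertex, because `V` is at least as large as the number of incidences. -/
theorem card_edgeSeqs_bounds_of_le_card {k D : ℕ} {d : V → ℕ} (hk : 1 ≤ k) (hD1 : 1 ≤ D)
    (hm : 16 * D ≤ Fintype.card ι) (hs : ∑ v, d v = k * Fintype.card ι)
    (hV : ∑ v, d v ≤ Fintype.card V) (hD : ∀ v, d v ≤ D) :
    Real.exp (-(loopMean k (Fintype.card ι) d * (1 + 8 * ((D : ℝ) / Fintype.card ι)))) *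
        configWeight k (Fintype.card ι) d ≤ (edgeSeqs ι k d).card ∧
      ((edgeSeqs ι k d).card : ℝ) ≤
        Real.exp (-(loopMean k (Fintype.card ι) d * (1 - 8 * ((D : ℝ) / Fintype.card ι)))) *
          configWeight k (Fintype.card ι) d := by
  induction hN : ∑ v, d v * (d v - 1) using Nat.strong_induction_on generalizing d with
  | _ N ih =>
  by_cases hall : ∀ v, d v ≤ 1
  · have h0 : loopMean k (Fintype.card ι) d = 0 := by
      unfold loopMean
      rw [Finset.sum_eq_zero, mul_zero, zero_div]
      intro v _
      have := hall v
      interval_cases d v <;> simp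
    have h1 : ((edgeSeqs ι k d).card : ℝ) = configWeight k (Fintype.card ι) d := by
      have hprod : ∏ v, ((d v).factorial : ℝ) = 1 :=
        Finset.prod_eq_one fun v _ => by rw [Nat.factorial_eq_one.2 (hall v), Nat.cast_one]
      unfold configWeight
      rw [hprod, mul_one, eq_div_iff (by positivity)]
      exact_mod_cast card_edgeSeqs_of_degree_le_one hall hs
    rw [h0, h1]
    simp
  · push Not at hall
    obtain ⟨a, ha⟩ := hall
    have hb : ∃ b, d b = 0 := by
      by_contra! h
      have : ∑ _v : V, 1 < ∑ v, d v :=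
        Finset.sum_lt_sum (fun v _ => Nat.one_le_iff_ne_zero.2 (h v)) ⟨a, Finset.mem_univ a, ha⟩
      simp at this
      omega
    obtain ⟨b, hb⟩ := hb
    have hab : a ≠ b := by rintro rfl; omega
    obtain ⟨α, hα⟩ : ∃ α, d a = α + 1 := ⟨d a - 1, by omega⟩
    have hα1 : 1 ≤ α := by omega
    set d' : V → ℕ := Function.update (Function.update d a α) b 1 with hd'
    have hd'b : d' b = 1 := by simp [hd']
    have hd'a : d' a = α := by simp [hd', hab]
    have hd'v : ∀ v, v ≠ a → v ≠ b → d' v = d v := fun v h1 h2 => by simp [hd', h1, h2]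
    have hsum : ∑ v, d' v = ∑ v, d v := by
      have := sum_add_eq_of_eq_off_pair hab hd'v fun x => x
      rw [hd'b, hd'a, hb, hα] at this
      omega
    have hlt : ∑ v, d' v * (d' v - 1) < N := by
      have h1 := sum_add_eq_of_eq_off_pair hab hd'v fun x => x * (x - 1)
      have h2 : α * (α - 1) < (α + 1) * α := by
        have : α * (α - 1) ≤ α * α := Nat.mul_le_mul_left _ (Nat.sub_le _ _)
        nlinarith
      simp only [hd'b, hd'a, hb, hα, Nat.add_sub_cancel] at h1
      omega
    have hD' : ∀ v, d' v ≤ D := fun v => by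
      by_cases h1 : v = b
      · rw [h1, hd'b]; exact hD1
      · by_cases h2 : v = a
        · have := hD a
          rw [h2, hd'a]; omega
        · rw [hd'v v h2 h1]; exact hD v
    have IH := ih _ hlt (hsum.trans hs) (hsum.le.trans hV) hD' rfl
    have step := card_sub_card_adjacent_bounds (ι := ι) (k := k) hab hd'b hD' hk hm
    have hmerge := degree_mul_card_edgeSeqs (ι := ι) (k := k) (d := d) (d' := d')
      (by rw [hd'a, hα]) hb hd'b hd'v
    have hmerge' : ((edgeSeqs ι k d').card : ℝ) -
        ((pointed ι k d' b).filter fun x => a ∈ x.1 x.2).card = d a * (edgeSeqs ι k d).card := by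
      rw [← hmerge]; push_cast; ring
    rw [hmerge', hd'a] at step
    have hlam : loopMean k (Fintype.card ι) d = loopMean k (Fintype.card ι) d' +
        (α : ℝ) * (k - 1) / (k * Fintype.card ι) := by
      have hm0 : (Fintype.card ι : ℝ) ≠ 0 := by
        have : 0 < Fintype.card ι := by omega
        positivity
      have hk0 : (k : ℝ) ≠ 0 := by positivity
      have h1 := sum_add_eq_of_eq_off_pair hab hd'v fun x => (x : ℝ) * ((x : ℝ) - 1)
      simp only [hd'b, hd'a, hb, hα] at h1
      push_cast at h1
      have h2 : ∑ v, (d v : ℝ) * ((d v : ℝ) - 1) =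
          ∑ v, (d' v : ℝ) * ((d' v : ℝ) - 1) + 2 * α := by linarith
      unfold loopMean
      rw [h2]
      field_simp
    have hW : configWeight k (Fintype.card ι) d' = d a * configWeight k (Fintype.card ι) d := by
      have h1 := prod_mul_eq_of_eq_off_pair hab hd'v fun x => (x.factorial : ℝ)
      simp only [hd'b, hd'a, hb, Nat.factorial_one, Nat.factorial_zero, Nat.cast_one, mul_one] at h1
      rw [hα, Nat.factorial_succ, ← hα] at h1
      have h2 : (α.factorial : ℝ) ≠ 0 := by exact_mod_cast Nat.factorial_ne_zero _
      have h3 : ∏ v, ((d v).factorial : ℝ) = d a * ∏ v, ((d' v).factorial : ℝ) := by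
        refine mul_right_cancel₀ h2 (h1.symm.trans ?_)
        push_cast
        ring
      have h4 : ∏ v, ((d' v).factorial : ℝ) ≠ 0 :=
        Finset.prod_ne_zero_iff.2 fun v _ => by exact_mod_cast Nat.factorial_ne_zero _
      have h5 : (d a : ℝ) ≠ 0 := by rw [hα]; positivity
      unfold configWeight
      rw [h3]
      field_simp
    have hda : (0 : ℝ) < d a := by exact_mod_cast (by omega : 0 < d a)
    rw [hW] at IH
    rw [hlam]
    constructor
    · refine le_of_mul_le_mul_left ?_ hda
      refine le_trans ?_ step.1
      refine le_trans ?_ (mul_le_mul_of_nonneg_left IH.1 (Real.exp_pos _).le)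
      refine le_of_eq ?_
      rw [← mul_assoc (Real.exp _) (Real.exp _), ← Real.exp_add, mul_left_comm]
      congr 3
      ring
    · refine le_of_mul_le_mul_left ?_ hda
      refine le_trans step.2 ?_
      refine le_trans (mul_le_mul_of_nonneg_left IH.2 (Real.exp_pos _).le) ?_
      refine le_of_eq ?_
      rw [← mul_assoc (Real.exp _) (Real.exp _), ← Real.exp_add, mul_left_comm]
      congr 3
      ring

/-- Adding isolated vertices does not change the count. -/
theorem card_edgeSeqs_sumElim_zero {W : Type*} [Fintype W] [DecidableEq W] (k : ℕ) (d : V → ℕ) :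
    (edgeSeqs ι k (Sum.elim d fun _ : W => 0)).card = (edgeSeqs ι k d).card := by
  symm
  refine Finset.card_nbij (fun F i => (F i).map Function.Embedding.inl) ?_ ?_ ?_
  · intro F hF
    simp only [Finset.mem_coe, mem_edgeSeqs] at hF ⊢
    refine ⟨fun i => by simpa using hF.1 i, ?_⟩
    rintro (v | w)
    · simpa using hF.2 v
    · simp
  · intro F _ G _ h
    funext i
    exact Finset.map_injective _ (congrFun h i)
  · intro F hF
    simp only [Finset.mem_coe, mem_edgeSeqs] at hF
    have hinr : ∀ i (w : W), Sum.inr w ∉ F i := fun i w h => by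
      have := hF.2 (Sum.inr w)
      simp only [Sum.elim_inr, Finset.card_eq_zero] at this
      exact Finset.notMem_empty i (this ▸ by simpa using h)
    have hmap : ∀ i, (F i).toLeft.map Function.Embedding.inl = F i := by
      intro i
      ext (v | w)
      · simp
      · simp [hinr]
    refine ⟨fun i => (F i).toLeft, ?_, funext hmap⟩
    simp only [Finset.mem_coe, mem_edgeSeqs]
    refine ⟨fun i => ?_, fun v => ?_⟩
    · rw [← hF.1 i, ← hmap i, Finset.card_map, hmap i]
    · simpa using hF.2 (Sum.inl v)

/-- The number of families with maximum degree at most `D` is, up to a relative error of size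
`D / m` in the exponent, the configuration count times `exp (-loopMean)`. -/
theorem card_edgeSeqs_bounds {k D : ℕ} {d : V → ℕ} (hk : 1 ≤ k) (hD1 : 1 ≤ D)
    (hm : 16 * D ≤ Fintype.card ι) (hs : ∑ v, d v = k * Fintype.card ι) (hD : ∀ v, d v ≤ D) :
    Real.exp (-(loopMean k (Fintype.card ι) d * (1 + 8 * ((D : ℝ) / Fintype.card ι)))) *
        configWeight k (Fintype.card ι) d ≤ (edgeSeqs ι k d).card ∧
      ((edgeSeqs ι k d).card : ℝ) ≤
        Real.exp (-(loopMean k (Fintype.card ι) d * (1 - 8 * ((D : ℝ) / Fintype.card ι)))) *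
          configWeight k (Fintype.card ι) d := by
  have h := card_edgeSeqs_bounds_of_le_card (ι := ι) (k := k) (D := D)
    (d := Sum.elim d fun _ : Fin (k * Fintype.card ι) => 0) hk hD1 hm (by simpa using hs)
    (by simp [hs]) (by rintro (v | w) <;> simp [hD])
  rw [card_edgeSeqs_sumElim_zero] at h
  have h1 : loopMean k (Fintype.card ι) (Sum.elim d fun _ : Fin (k * Fintype.card ι) => 0) =
      loopMean k (Fintype.card ι) d := by
    simp [loopMean]
  have h2 : configWeight k (Fintype.card ι) (Sum.elim d fun _ : Fin (k * Fintype.card ι) => 0) =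
      configWeight k (Fintype.card ι) d := by
    simp [configWeight]
  rwa [h1, h2] at h

end Count

/-! ### Falling factorials and elementary symmetric sums -/

section Factorials

theorem descFactorial_le_pow_real (N r : ℕ) : (N.descFactorial r : ℝ) ≤ (N : ℝ) ^ r := by
  exact_mod_cast Nat.descFactorial_le_pow N r

theorem exp_neg_mul_two_le_one_sub {x : ℝ} (h0 : 0 ≤ x) (h1 : x ≤ 1 / 2) :
    Real.exp (-(x * 2)) ≤ 1 - x := by
  have h2 : 0 < 1 - x := by linarith
  have h3 := Real.add_one_le_exp (x * 2)
  rw [Real.exp_neg, inv_le_comm₀ (Real.exp_pos _) h2, inv_le_iff_one_le_mul₀ h2]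
  nlinarith

theorem descFactorial_eq_pow_mul_prod {N r : ℕ} (hr : r ≤ N) (hN : 0 < N) :
    (N.descFactorial r : ℝ) = (N : ℝ) ^ r * ∏ i ∈ Finset.range r, (1 - (i : ℝ) / N) := by
  have hN' : (N : ℝ) ≠ 0 := by positivity
  have hpow : (N : ℝ) ^ r = ∏ _i ∈ Finset.range r, (N : ℝ) := by simp
  rw [Nat.descFactorial_eq_prod_range, hpow, ← Finset.prod_mul_distrib]
  push_cast
  refine Finset.prod_congr rfl fun i hi => ?_
  rw [Finset.mem_range] at hi
  rw [Nat.cast_sub (by omega)]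
  field_simp

theorem le_descFactorial {N r : ℕ} (hr : 2 * r ≤ N) (hN : 0 < N) :
    (N : ℝ) ^ r * Real.exp (-((r : ℝ) ^ 2 / N)) ≤ N.descFactorial r := by
  rw [descFactorial_eq_pow_mul_prod (by omega) hN]
  have hNr : (0 : ℝ) < N := by exact_mod_cast hN
  refine mul_le_mul_of_nonneg_left ?_ (by positivity)
  calc Real.exp (-((r : ℝ) ^ 2 / N)) ≤ ∏ i ∈ Finset.range r, Real.exp (-((i : ℝ) / N * 2)) := by
        rw [← Real.exp_sum, Real.exp_le_exp, Finset.sum_neg_distrib, neg_le_neg_iff,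
          ← Finset.sum_mul, ← Finset.sum_div, div_mul_eq_mul_div]
        refine div_le_div_of_nonneg_right ?_ hNr.le
        have h := Finset.sum_range_id_mul_two r
        have h2 : (∑ i ∈ Finset.range r, (i : ℝ)) * 2 = ((r * (r - 1) : ℕ) : ℝ) := by
          rw [← h]; push_cast; ring
        rw [h2, sq]
        exact_mod_cast Nat.mul_le_mul_left _ (Nat.sub_le _ _)
    _ ≤ _ := by
        refine Finset.prod_le_prod (fun i _ => (Real.exp_pos _).le) fun i hi => ?_
        rw [Finset.mem_range] at hi
        refine exp_neg_mul_two_le_one_sub (by positivity) ?_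
        rw [div_le_iff₀ hNr]
        have : (2 : ℝ) * i ≤ N := by exact_mod_cast (by omega : 2 * i ≤ N)
        linarith

theorem pow_succ_add_le_add_pow {x y : ℝ} (hx : 0 ≤ x) (hy : 0 ≤ y) (k : ℕ) :
    x ^ (k + 1) + (k + 1) * y * x ^ k ≤ (x + y) ^ (k + 1) := by
  induction k with
  | zero => simp
  | succ k ih =>
    have h1 : 0 ≤ y * (y * x ^ k) := by positivity
    calc x ^ (k + 1 + 1) + ((k + 1 : ℕ) + 1) * y * x ^ (k + 1)
        ≤ (x ^ (k + 1) + (k + 1) * y * x ^ k) * (x + y) := by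
          push_cast
          have h2 : 0 ≤ (k : ℝ) * (y * (y * x ^ k)) := by positivity
          rw [pow_succ x (k + 1), pow_succ x k]
          nlinarith
      _ ≤ (x + y) ^ (k + 1) * (x + y) := by gcongr
      _ = _ := by ring

/-- A Maclaurin inequality: `k!` times the `k`-th elementary symmetric sum is at most the `k`-th power
of the sum. -/
theorem factorial_mul_sum_powersetCard_prod_le {V : Type*} [DecidableEq V] (s : Finset V)
    {f : V → ℝ} (hf : ∀ v, 0 ≤ f v) (k : ℕ) :
    k.factorial * ∑ e ∈ s.powersetCard k, ∏ v ∈ e, f v ≤ (∑ v ∈ s, f v) ^ k := by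
  induction s using Finset.induction_on generalizing k with
  | empty =>
    cases k with
    | zero => simp
    | succ k =>
      rw [Finset.powersetCard_eq_empty.2 (by simp)]
      simp
  | insert a s ha ih =>
    cases k with
    | zero => simp
    | succ k =>
      have hinj : Set.InjOn (insert a) (s.powersetCard k : Set (Finset V)) := by
        intro e he e' he' h
        simp only [Finset.mem_coe, Finset.mem_powersetCard] at he he'
        have h1 : a ∉ e := fun h => ha (he.1 h)
        have h2 : a ∉ e' := fun h => ha (he'.1 h)
        rw [← Finset.erase_insert h1, h, Finset.erase_insert h2]
      have hdisj : Disjoint (s.powersetCard (k + 1)) ((s.powersetCard k).image (insert a)) := by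
        rw [Finset.disjoint_left]
        intro e he h
        obtain ⟨e', -, rfl⟩ := Finset.mem_image.1 h
        exact ha ((Finset.mem_powersetCard.1 he).1 (Finset.mem_insert_self _ _))
      rw [Finset.powersetCard_succ_insert ha, Finset.sum_union hdisj, Finset.sum_image hinj,
        Finset.sum_insert ha]
      have h1 : ∑ e ∈ s.powersetCard k, ∏ v ∈ insert a e, f v =
          f a * ∑ e ∈ s.powersetCard k, ∏ v ∈ e, f v := by
        rw [Finset.mul_sum]
        refine Finset.sum_congr rfl fun e he => ?_
        exact Finset.prod_insert fun h => ha ((Finset.mem_powersetCard.1 he).1 h)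
      rw [h1, add_comm (f a)]
      refine le_trans ?_ (pow_succ_add_le_add_pow (Finset.sum_nonneg fun v _ => hf v) (hf a) k)
      have h2 := ih (k + 1)
      have h3 := mul_le_mul_of_nonneg_left (ih k) (mul_nonneg (by positivity : (0 : ℝ) ≤ k + 1) (hf a))
      rw [mul_add]
      refine add_le_add h2 (le_trans (le_of_eq ?_) h3)
      rw [Nat.factorial_succ]
      push_cast
      ring

end Factorials

/-! ### Deleting two equal edges -/

section Repetitions

variable {ι V : Type*} [Fintype ι] [DecidableEq ι] [Fintype V] [DecidableEq V]

/-- Deleting two equal members. -/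
theorem card_edgeSeqs_eq_le_sum {k : ℕ} {d : V → ℕ} {i j : ι} (hij : i ≠ j) :
    ((edgeSeqs ι k d).filter fun F => F i = F j).card ≤
      ∑ e ∈ (Finset.univ.filter fun v => 2 ≤ d v).powersetCard k,
        (edgeSeqs {l // l ≠ i ∧ l ≠ j} k fun v => d v - if v ∈ e then 2 else 0).card := by
  rw [← Finset.card_sigma]
  have hcount : ∀ F : ι → Finset V, F i = F j → ∀ v,
      (Finset.univ.filter fun l => v ∈ F l).card =
        (Finset.univ.filter fun l : {l // l ≠ i ∧ l ≠ j} => v ∈ F l).card +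
          if v ∈ F i then 2 else 0 := by
    intro F h v
    have h1 : (Finset.univ.filter fun l : {l // l ≠ i ∧ l ≠ j} => v ∈ F l).card =
        (Finset.univ.filter fun l => (l ≠ i ∧ l ≠ j) ∧ v ∈ F l).card := by
      rw [← Finset.card_map (Function.Embedding.subtype _)]
      congr 1
      ext l
      simp
      tauto
    have h2 : (if v ∈ F i then 2 else 0) =
        (Finset.univ.filter fun l => (l = i ∨ l = j) ∧ v ∈ F l).card := by
      split_ifs with hv
      · have : (Finset.univ.filter fun l => (l = i ∨ l = j) ∧ v ∈ F l) = {i, j} := by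
          ext l
          simp only [Finset.mem_filter, Finset.mem_univ, true_and, Finset.mem_insert,
            Finset.mem_singleton, and_iff_left_iff_imp]
          rintro (rfl | rfl)
          · exact hv
          · exact h ▸ hv
        rw [this, Finset.card_pair hij]
      · symm
        rw [Finset.card_eq_zero, Finset.filter_eq_empty_iff]
        rintro l - ⟨rfl | rfl, hl⟩
        · exact hv hl
        · exact hv (h ▸ hl)
    rw [h1, h2, ← Finset.card_union_of_disjoint]
    · congr 1
      ext l
      simp only [Finset.mem_filter, Finset.mem_univ, true_and, Finset.mem_union]
      tauto
    · rw [Finset.disjoint_filter]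
      tauto
  refine Finset.card_le_card_of_injOn (fun F => ⟨F i, fun l => F l⟩) ?_ ?_
  · intro F hF
    simp only [Finset.mem_coe, Finset.mem_filter, mem_edgeSeqs, Finset.mem_sigma,
      Finset.mem_powersetCard] at hF ⊢
    obtain ⟨⟨h1, h2⟩, h3⟩ := hF
    refine ⟨⟨fun v hv => ?_, h1 i⟩, fun l => h1 l, fun v => ?_⟩
    · have := hcount F h3 v
      rw [h2, if_pos hv] at this
      simp only [Finset.mem_filter, Finset.mem_univ, true_and]
      omega
    · have := hcount F h3 v
      rw [h2] at this
      omega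
  · intro F hF G hG h
    simp only [Finset.mem_coe, Finset.mem_filter] at hF hG
    simp only [Sigma.mk.injEq] at h
    obtain ⟨h1, h2⟩ := h
    have h2 := eq_of_heq h2
    funext l
    by_cases hi : l = i
    · rw [hi, h1]
    · by_cases hj : l = j
      · rw [hj, ← hF.2, ← hG.2, h1]
      · exact congrFun h2 ⟨l, hi, hj⟩

theorem loopMean_le {k m D : ℕ} {d : V → ℕ} (hk : 1 ≤ k) (hm : 1 ≤ m)
    (hs : ∑ v, d v = k * m) (hD : ∀ v, d v ≤ D) : loopMean k m d ≤ k * D / 2 := by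
  have hk' : (1 : ℝ) ≤ k := by exact_mod_cast hk
  have hm' : (1 : ℝ) ≤ m := by exact_mod_cast hm
  have h1 : ∑ v, (d v : ℝ) * ((d v : ℝ) - 1) ≤ (k * m) * D := by
    have : ((k : ℝ) * m) = ∑ v, (d v : ℝ) := by exact_mod_cast hs.symm
    rw [this, Finset.sum_mul]
    refine Finset.sum_le_sum fun v _ => ?_
    have : (d v : ℝ) ≤ D := by exact_mod_cast hD v
    exact mul_le_mul_of_nonneg_left (by linarith) (Nat.cast_nonneg _)
  unfold loopMean
  rw [div_le_div_iff₀ (by positivity) (by norm_num)]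
  have h2 : ((k : ℝ) - 1) * (∑ v, (d v : ℝ) * ((d v : ℝ) - 1)) ≤ k * ((k * m) * D) := by
    refine (mul_le_mul_of_nonneg_left h1 (by linarith)).trans ?_
    exact mul_le_mul_of_nonneg_right (by linarith) (by positivity)
  nlinarith

theorem sum_sub_indicator {k m c : ℕ} {d : V → ℕ} {e : Finset V} (he : e.card = k)
    (hed : ∀ v ∈ e, c ≤ d v) (hs : ∑ v, d v = k * (m + c)) :
    ∑ v, (d v - if v ∈ e then c else 0) = k * m := by
  rw [Finset.sum_tsub_distrib _ fun v _ => ?_, hs]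
  · simp [he, mul_add]
  · split_ifs with hv
    · exact hed v hv
    · exact Nat.zero_le _

/-- Deleting two copies of an edge decreases the expected number of loops by little. -/
theorem loopMean_le_loopMean_sub {k m D : ℕ} {d : V → ℕ} {e : Finset V} (hk : 1 ≤ k) (hm : 1 ≤ m)
    (he : e.card = k) (hed : ∀ v ∈ e, 2 ≤ d v) (hD : ∀ v, d v ≤ D) :
    loopMean k (m + 2) d ≤
      loopMean k m (fun v => d v - if v ∈ e then 2 else 0) + 2 * k * D / (m + 2 : ℕ) := by
  set d' : V → ℕ := fun v => d v - if v ∈ e then 2 else 0 with hd'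
  have hk' : (1 : ℝ) ≤ k := by exact_mod_cast hk
  have hm' : (1 : ℝ) ≤ m := by exact_mod_cast hm
  have h1 : ∑ v, (d v : ℝ) * ((d v : ℝ) - 1) ≤
      ∑ v, (d' v : ℝ) * ((d' v : ℝ) - 1) + 4 * k * D := by
    have : (4 * k * D : ℝ) = ∑ v, if v ∈ e then 4 * (D : ℝ) else 0 := by
      rw [← Finset.sum_filter, Finset.filter_univ_mem, Finset.sum_const, he, nsmul_eq_mul]
      ring
    rw [this, ← Finset.sum_add_distrib]
    refine Finset.sum_le_sum fun v _ => ?_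
    by_cases hv : v ∈ e
    · have h2 : (d' v : ℝ) = d v - 2 := by
        simp only [hd', hv, if_true]
        rw [Nat.cast_sub (hed v hv)]
        norm_num
      have : (d v : ℝ) ≤ D := by exact_mod_cast hD v
      rw [h2, if_pos hv]
      nlinarith
    · simp [hd', hv]
  have h0 : 0 ≤ loopMean k m d' := loopMean_nonneg hk m d'
  have h2 : loopMean k (m + 2) d ≤
      ((k : ℝ) - 1) * (∑ v, (d' v : ℝ) * ((d' v : ℝ) - 1) + 4 * k * D) /
        (2 * ((k : ℝ) * (m + 2 : ℕ))) := by
    unfold loopMean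
    refine div_le_div_of_nonneg_right ?_ (by positivity)
    exact mul_le_mul_of_nonneg_left h1 (by linarith)
  refine h2.trans ?_
  rw [mul_add, add_div]
  refine add_le_add ?_ ?_
  · unfold loopMean at h0 ⊢
    have h3 : 0 ≤ ((k : ℝ) - 1) * (∑ v, (d' v : ℝ) * ((d' v : ℝ) - 1)) := by
      by_contra! h
      exact absurd h0 (not_le.2 (div_neg_of_neg_of_pos h (by positivity)))
    refine div_le_div_of_nonneg_left h3 (by positivity) ?_
    push_cast
    nlinarith
  · rw [div_le_div_iff₀ (by positivity) (by positivity)]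
    have : 0 ≤ (k : ℝ) * D * (m + 2 : ℕ) := by positivity
    nlinarith

/-- Deleting two copies of an edge `e` changes the configuration weight by an explicit factor. -/
theorem configWeight_sub_mul {k m : ℕ} {d : V → ℕ} {e : Finset V}
    (hed : ∀ v ∈ e, 2 ≤ d v) :
    configWeight k m (fun v => d v - if v ∈ e then 2 else 0) *
        ((k * (m + 2)).descFactorial (2 * k) : ℝ) =
      configWeight k (m + 2) d * ((k.factorial : ℝ) ^ 2 * ∏ v ∈ e, ((d v : ℝ) * ((d v : ℝ) - 1))) := by
  have h1 : ∏ v, ((d v).factorial : ℝ) =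
      (∏ v, ((d v - if v ∈ e then 2 else 0).factorial : ℝ)) *
        ∏ v ∈ e, ((d v : ℝ) * ((d v : ℝ) - 1)) := by
    have : ∏ v ∈ e, ((d v : ℝ) * ((d v : ℝ) - 1)) =
        ∏ v, if v ∈ e then ((d v : ℝ) * ((d v : ℝ) - 1)) else 1 := by
      rw [← Finset.prod_filter, Finset.filter_univ_mem]
    rw [this, ← Finset.prod_mul_distrib]
    refine Finset.prod_congr rfl fun v _ => ?_
    by_cases hv : v ∈ e
    · obtain ⟨c, hc⟩ : ∃ c, d v = c + 2 := ⟨d v - 2, by have := hed v hv; omega⟩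
      simp only [hv, if_true, hc, Nat.add_sub_cancel, Nat.factorial_succ]
      push_cast
      ring
    · simp [hv]
  have h2 : ((k * (m + 2)).factorial : ℝ) =
      (k * m).factorial * ((k * (m + 2)).descFactorial (2 * k) : ℝ) := by
    have := Nat.factorial_mul_descFactorial (n := k * (m + 2)) (k := 2 * k) (by nlinarith)
    rw [show k * (m + 2) - 2 * k = k * m by rw [mul_add, mul_comm 2 k, Nat.add_sub_cancel]] at this
    rw [← this]
    push_cast
    ring
  have h3 : ∏ v, ((d v - if v ∈ e then 2 else 0).factorial : ℝ) ≠ 0 :=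
    Finset.prod_ne_zero_iff.2 fun v _ => by exact_mod_cast Nat.factorial_ne_zero _
  have h4 : ∏ v ∈ e, ((d v : ℝ) * ((d v : ℝ) - 1)) ≠ 0 :=
    Finset.prod_ne_zero_iff.2 fun v hv => by
      have : (2 : ℝ) ≤ d v := by exact_mod_cast hed v hv
      exact mul_ne_zero (by linarith) (by linarith)
  have h5 : (k.factorial : ℝ) ≠ 0 := by exact_mod_cast Nat.factorial_ne_zero _
  unfold configWeight
  rw [h1, h2, pow_add]
  field_simp

end Repetitions

/-! ### Repeated edges and simple hypergraphs -/

section SimpleCount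

variable {ι V : Type*} [Fintype ι] [DecidableEq ι] [Fintype V] [DecidableEq V]

/-- The number of families that remain after two copies of an edge have been deleted. -/
theorem card_edgeSeqs_sub_le {κ : Type*} [Fintype κ] [DecidableEq κ] {k m D : ℕ} {d : V → ℕ}
    {e : Finset V} (hι : Fintype.card ι = m + 2) (hκ : Fintype.card κ = m) (hk : 1 ≤ k)
    (hD1 : 1 ≤ D) (hm : 32 * D ≤ m + 2) (hs : ∑ v, d v = k * (m + 2)) (hD : ∀ v, d v ≤ D)
    (hkD : k * D ^ 2 ≤ 3 * (m + 2)) (he : e.card = k) (hed : ∀ v ∈ e, 2 ≤ d v) :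
    ((edgeSeqs κ k fun v => d v - if v ∈ e then 2 else 0).card : ℝ) *
        ((k * (m + 2)).descFactorial (2 * k) : ℝ) ≤
      Real.exp 42 * (edgeSeqs ι k d).card *
        ((k.factorial : ℝ) ^ 2 * ∏ v ∈ e, ((d v : ℝ) * ((d v : ℝ) - 1))) := by
  set d' : V → ℕ := fun v => d v - if v ∈ e then 2 else 0 with hd'
  have hs' : ∑ v, d' v = k * m := sum_sub_indicator he hed hs
  have hD' : ∀ v, d' v ≤ D := fun v => (Nat.sub_le _ _).trans (hD v)
  have hm1 : 1 ≤ m := by omega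
  have up := (card_edgeSeqs_bounds (ι := κ) (k := k) (D := D) (d := d') hk hD1 (by omega)
    (by rw [hκ]; exact hs') hD').2
  have low := (card_edgeSeqs_bounds (ι := ι) (k := k) (D := D) (d := d) hk hD1 (by omega)
    (by rw [hι]; exact hs) hD).1
  rw [hκ] at up
  rw [hι] at low
  have hW := configWeight_sub_mul (k := k) (m := m) hed
  have hWpos := configWeight_pos k (m + 2) d
  have hl1 := loopMean_le hk (by omega) hs hD
  have hl2 := loopMean_le hk hm1 hs' hD'
  have hl3 := loopMean_le_loopMean_sub hk hm1 he hed hD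
  have hl0 := loopMean_nonneg hk (m + 2) d
  have hl0' := loopMean_nonneg hk m d'
  rw [← hd'] at hW hl3
  set L := loopMean k (m + 2) d
  set L' := loopMean k m d'
  set A : ℝ := ((edgeSeqs ι k d).card : ℝ)
  set A' : ℝ := ((edgeSeqs κ k d').card : ℝ)
  set W := configWeight k (m + 2) d
  set W' := configWeight k m d'
  set P : ℝ := (k.factorial : ℝ) ^ 2 * ∏ v ∈ e, ((d v : ℝ) * ((d v : ℝ) - 1))
  set T : ℝ := ((k * (m + 2)).descFactorial (2 * k) : ℝ)
  have hT : 0 ≤ T := Nat.cast_nonneg _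
  have hP : 0 ≤ P := mul_nonneg (by positivity)
    (Finset.prod_nonneg fun v _ => natCast_mul_sub_one_nonneg _)
  have hmr : (1 : ℝ) ≤ m := by exact_mod_cast hm1
  have hDr : (1 : ℝ) ≤ D := by exact_mod_cast hD1
  have hkr : (1 : ℝ) ≤ k := by exact_mod_cast hk
  have hM : (0 : ℝ) < (m + 2 : ℕ) := by positivity
  -- each part of the exponent is a multiple of `k * D ^ 2 / (m + 2)`, which is at most `3`
  have hκ3 : (k : ℝ) * D * (D / (m + 2 : ℕ)) ≤ 3 := by
    rw [← mul_div_assoc, div_le_iff₀ hM]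
    have : (k * D ^ 2 : ℝ) ≤ 3 * (m + 2 : ℕ) := by exact_mod_cast hkD
    nlinarith
  have hδ' : (D : ℝ) / m ≤ 2 * (D / (m + 2 : ℕ)) := by
    rw [← mul_div_assoc, div_le_div_iff₀ (by positivity) hM]
    have : (2 : ℝ) ≤ m := by exact_mod_cast (by omega : 2 ≤ m)
    push_cast
    nlinarith
  have hδ0 : (0 : ℝ) ≤ D / (m + 2 : ℕ) := by positivity
  have hkδ : 2 * k * D / (m + 2 : ℕ) ≤ 2 * ((k : ℝ) * D * (D / (m + 2 : ℕ))) := by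
    rw [← mul_div_assoc, ← mul_div_assoc]
    refine div_le_div_of_nonneg_right ?_ hM.le
    have : (0 : ℝ) ≤ k * D := by positivity
    nlinarith
  have hexp : L * (1 + 8 * ((D : ℝ) / (m + 2 : ℕ))) - L' * (1 - 8 * ((D : ℝ) / m)) ≤ 42 := by
    have e1 : L * ((D : ℝ) / (m + 2 : ℕ)) ≤ k * D / 2 * (D / (m + 2 : ℕ)) :=
      mul_le_mul_of_nonneg_right hl1 hδ0
    have e2 : L' * ((D : ℝ) / m) ≤ k * D / 2 * (2 * (D / (m + 2 : ℕ))) :=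
      mul_le_mul hl2 hδ' (by positivity) (by positivity)
    nlinarith
  have hA : W ≤ Real.exp (L * (1 + 8 * ((D : ℝ) / (m + 2 : ℕ)))) * A := by
    have := mul_le_mul_of_nonneg_left low
      (Real.exp_pos (L * (1 + 8 * ((D : ℝ) / (m + 2 : ℕ))))).le
    rwa [← mul_assoc, ← Real.exp_add, add_neg_cancel, Real.exp_zero, one_mul] at this
  calc A' * T ≤ Real.exp (-(L' * (1 - 8 * ((D : ℝ) / m)))) * W' * T :=
        mul_le_mul_of_nonneg_right up hT
    _ = Real.exp (-(L' * (1 - 8 * ((D : ℝ) / m)))) * W * P := by rw [mul_assoc, hW, mul_assoc]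
    _ ≤ Real.exp (-(L' * (1 - 8 * ((D : ℝ) / m)))) *
        (Real.exp (L * (1 + 8 * ((D : ℝ) / (m + 2 : ℕ)))) * A) * P := by gcongr
    _ = Real.exp (L * (1 + 8 * ((D : ℝ) / (m + 2 : ℕ))) - L' * (1 - 8 * ((D : ℝ) / m))) *
        A * P := by
        rw [← mul_assoc (Real.exp _) (Real.exp _), ← Real.exp_add, neg_add_eq_sub]
    _ ≤ _ := by gcongr

/-- The proportion of families in which two given members coincide. -/
theorem card_edgeSeqs_eq_le {k D : ℕ} {d : V → ℕ} (hk : 1 ≤ k) (hD1 : 1 ≤ D)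
    (hm : 32 * D ≤ Fintype.card ι) (hs : ∑ v, d v = k * Fintype.card ι) (hD : ∀ v, d v ≤ D)
    (hkD : k * D ^ 2 ≤ 3 * Fintype.card ι) (hkm : k ≤ Fintype.card ι) {i j : ι} (hij : i ≠ j) :
    (((edgeSeqs ι k d).filter fun F => F i = F j).card : ℝ) ≤
      Real.exp 46 * ((D : ℝ) / Fintype.card ι) ^ k * (edgeSeqs ι k d).card := by
  obtain ⟨m, hι⟩ : ∃ m, Fintype.card ι = m + 2 := ⟨Fintype.card ι - 2, by omega⟩
  have hκ : Fintype.card {l // l ≠ i ∧ l ≠ j} = m := by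
    rw [Fintype.card_subtype]
    have : (Finset.univ.filter fun l => l ≠ i ∧ l ≠ j) = (Finset.univ.erase i).erase j := by
      ext l; simp [and_comm]
    rw [this, Finset.card_erase_of_mem (Finset.mem_erase.2 ⟨hij.symm, Finset.mem_univ _⟩),
      Finset.card_erase_of_mem (Finset.mem_univ _), Finset.card_univ, hι]
    omega
  rw [hι] at hm hs hkD hkm ⊢
  set T : ℝ := ((k * (m + 2)).descFactorial (2 * k) : ℝ) with hTdef
  set A : ℝ := ((edgeSeqs ι k d).card : ℝ)
  set s : Finset V := Finset.univ.filter fun v => 2 ≤ d v with hsdef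
  have hkr : (1 : ℝ) ≤ k := by exact_mod_cast hk
  have hM : (0 : ℝ) < (m + 2 : ℕ) := by positivity
  have h4 : 4 * 1 ≤ m + 2 := by omega
  have hT : ((k : ℝ) * (m + 2 : ℕ)) ^ (2 * k) * Real.exp (-4) ≤ T := by
    have h1 := le_descFactorial (N := k * (m + 2)) (r := 2 * k) (by nlinarith) (by positivity)
    refine le_trans ?_ h1
    rw [Nat.cast_mul]
    refine mul_le_mul_of_nonneg_left (Real.exp_le_exp.2 (neg_le_neg ?_)) (by positivity)
    rw [div_le_iff₀ (by positivity)]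
    have : (k : ℝ) ≤ (m + 2 : ℕ) := by exact_mod_cast hkm
    push_cast at this ⊢
    nlinarith
  have hTpos : 0 < T := lt_of_lt_of_le (by positivity) hT
  have hsum : (((edgeSeqs ι k d).filter fun F => F i = F j).card : ℝ) * T ≤
      Real.exp 42 * A * (k.factorial * ((k : ℝ) * (m + 2 : ℕ) * D) ^ k) := by
    calc (((edgeSeqs ι k d).filter fun F => F i = F j).card : ℝ) * T
        ≤ (∑ e ∈ s.powersetCard k, ((edgeSeqs {l // l ≠ i ∧ l ≠ j} k
            fun v => d v - if v ∈ e then 2 else 0).card : ℝ)) * T := by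
          refine mul_le_mul_of_nonneg_right ?_ hTpos.le
          exact_mod_cast card_edgeSeqs_eq_le_sum hij
      _ ≤ ∑ e ∈ s.powersetCard k, Real.exp 42 * A *
            ((k.factorial : ℝ) ^ 2 * ∏ v ∈ e, ((d v : ℝ) * ((d v : ℝ) - 1))) := by
          rw [Finset.sum_mul]
          refine Finset.sum_le_sum fun e he => ?_
          rw [Finset.mem_powersetCard] at he
          exact card_edgeSeqs_sub_le hι hκ hk hD1 hm hs hD hkD he.2
            fun v hv => (Finset.mem_filter.1 (he.1 hv)).2
      _ = Real.exp 42 * A * (k.factorial * (k.factorial *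
            ∑ e ∈ s.powersetCard k, ∏ v ∈ e, ((d v : ℝ) * ((d v : ℝ) - 1)))) := by
          rw [← Finset.mul_sum, ← Finset.mul_sum]; ring
      _ ≤ _ := by
          have h5 := factorial_mul_sum_powersetCard_prod_le s
            (f := fun v => (d v : ℝ) * ((d v : ℝ) - 1)) (fun v => natCast_mul_sub_one_nonneg _) k
          have h6 : ∑ v ∈ s, (d v : ℝ) * ((d v : ℝ) - 1) ≤ (k : ℝ) * (m + 2 : ℕ) * D := by
            refine (Finset.sum_le_univ_sum_of_nonneg fun v => natCast_mul_sub_one_nonneg _).trans ?_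
            have : ((k : ℝ) * (m + 2 : ℕ)) = ∑ v, (d v : ℝ) := by exact_mod_cast hs.symm
            rw [this, Finset.sum_mul]
            refine Finset.sum_le_sum fun v _ => ?_
            have : (d v : ℝ) ≤ D := by exact_mod_cast hD v
            exact mul_le_mul_of_nonneg_left (by linarith) (Nat.cast_nonneg _)
          have h7 := h5.trans (pow_le_pow_left₀
            (Finset.sum_nonneg fun v _ => natCast_mul_sub_one_nonneg _) h6 k)
          gcongr
  refine le_of_mul_le_mul_right (hsum.trans ?_) hTpos
  have hfac : (k.factorial : ℝ) ≤ (k : ℝ) ^ k := by exact_mod_cast Nat.factorial_le_pow k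
  calc Real.exp 42 * A * (k.factorial * ((k : ℝ) * (m + 2 : ℕ) * D) ^ k)
      ≤ Real.exp 42 * A * ((k : ℝ) ^ k * ((k : ℝ) * (m + 2 : ℕ) * D) ^ k) := by gcongr
    _ = Real.exp 46 * ((D : ℝ) / (m + 2 : ℕ)) ^ k * A *
          (((k : ℝ) * (m + 2 : ℕ)) ^ (2 * k) * Real.exp (-4)) := by
        have e1 : Real.exp 46 = Real.exp 42 * Real.exp 4 := by rw [← Real.exp_add]; norm_num
        have e2 : Real.exp 4 * Real.exp (-4) = 1 := by rw [← Real.exp_add]; norm_num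
        have e3 : ((k : ℝ) ^ k * ((k : ℝ) * (m + 2 : ℕ) * D) ^ k) =
            ((D : ℝ) / (m + 2 : ℕ)) ^ k * ((k : ℝ) * (m + 2 : ℕ)) ^ (2 * k) := by
          rw [pow_mul, ← mul_pow, ← mul_pow]
          congr 1
          field_simp
        rw [e3, e1]
        linear_combination (-(Real.exp 42 * A * (((D : ℝ) / (m + 2 : ℕ)) ^ k *
          ((k : ℝ) * (m + 2 : ℕ)) ^ (2 * k)))) * e2
    _ ≤ _ := by gcongr

/-- Few of the families have two equal members. -/
theorem card_edgeSeqs_le_add_card_injective {k D : ℕ} {d : V → ℕ} (hk : 1 ≤ k) (hD1 : 1 ≤ D)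
    (hm : 32 * D ≤ Fintype.card ι) (hs : ∑ v, d v = k * Fintype.card ι) (hD : ∀ v, d v ≤ D)
    (hkD : k * D ^ 2 ≤ 3 * Fintype.card ι) (hkm : k ≤ Fintype.card ι) :
    ((edgeSeqs ι k d).card : ℝ) *
        (1 - Real.exp 46 * ((Fintype.card ι : ℝ) ^ 2 * ((D : ℝ) / Fintype.card ι) ^ k)) ≤
      ((edgeSeqs ι k d).filter fun F => Function.Injective F).card := by
  classical
  have h1 : (edgeSeqs ι k d).card ≤
      ((edgeSeqs ι k d).filter fun F => Function.Injective F).card +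
        ∑ x : ι × ι with x.1 ≠ x.2, ((edgeSeqs ι k d).filter fun F => F x.1 = F x.2).card := by
    rw [← Finset.card_filter_add_card_filter_not (s := edgeSeqs ι k d)
      (fun F => Function.Injective F)]
    refine Nat.add_le_add_left (le_trans (Finset.card_le_card fun F hF => ?_)
      Finset.card_biUnion_le) _
    rw [Finset.mem_filter] at hF
    have h := hF.2
    unfold Function.Injective at h
    push Not at h
    obtain ⟨i, j, h2, h3⟩ := h
    rw [Finset.mem_biUnion]
    exact ⟨(i, j), by simpa using h3, Finset.mem_filter.2 ⟨hF.1, h2⟩⟩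
  have h2 : ((∑ x : ι × ι with x.1 ≠ x.2,
      ((edgeSeqs ι k d).filter fun F => F x.1 = F x.2).card : ℕ) : ℝ) ≤
      (Fintype.card ι : ℝ) ^ 2 *
        (Real.exp 46 * ((D : ℝ) / Fintype.card ι) ^ k * (edgeSeqs ι k d).card) := by
    push_cast
    refine (Finset.sum_le_card_nsmul _ _ _ fun x hx =>
      card_edgeSeqs_eq_le hk hD1 hm hs hD hkD hkm (Finset.mem_filter.1 hx).2).trans ?_
    rw [nsmul_eq_mul]
    refine mul_le_mul_of_nonneg_right ?_ (by positivity)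
    have : (Finset.univ.filter fun x : ι × ι => x.1 ≠ x.2).card ≤ Fintype.card ι ^ 2 := by
      refine (Finset.card_filter_le _ _).trans ?_
      rw [Finset.card_univ, Fintype.card_prod, sq]
    exact_mod_cast this
  have h3 : ((edgeSeqs ι k d).card : ℝ) ≤
      ((edgeSeqs ι k d).filter fun F => Function.Injective F).card +
      ((∑ x : ι × ι with x.1 ≠ x.2,
        ((edgeSeqs ι k d).filter fun F => F x.1 = F x.2).card : ℕ) : ℝ) := by
    exact_mod_cast h1
  nlinarith

/-- A set of `m` elements has `m!` enumerations. -/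
theorem card_injective_image_eq {α : Type*} [Fintype α] [DecidableEq α] {m : ℕ} {s : Finset α}
    (hs : s.card = m) :
    (Finset.univ.filter fun F : Fin m → α => Function.Injective F ∧ Finset.univ.image F = s).card =
      m.factorial := by
  have hperm : m.factorial = (Finset.univ : Finset (Equiv.Perm (Fin m))).card := by
    rw [Finset.card_univ, Fintype.card_perm, Fintype.card_fin]
  rw [hperm]
  symm
  have e : Fin m ≃ s := (s.equivFinOfCardEq hs).symm
  refine Finset.card_nbij (fun σ i => (e (σ i) : α)) ?_ ?_ ?_
  · intro σ _
    simp only [Finset.coe_filter, Finset.mem_univ, true_and, Set.mem_ofPred_eq]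
    refine ⟨fun i j h => σ.injective (e.injective (Subtype.ext h)), ?_⟩
    ext x
    simp only [Finset.mem_image, Finset.mem_univ, true_and]
    refine ⟨?_, fun hx => ⟨σ.symm (e.symm ⟨x, hx⟩), by simp⟩⟩
    rintro ⟨i, rfl⟩
    exact (e (σ i)).2
  · intro σ _ τ _ h
    ext i
    exact congrArg Fin.val (e.injective (Subtype.ext (congrFun h i)))
  · intro F hF
    simp only [Finset.coe_filter, Finset.mem_univ, true_and, Set.mem_ofPred_eq] at hF
    have hmem : ∀ i, F i ∈ s := fun i => by
      rw [← hF.2]; exact Finset.mem_image_of_mem _ (Finset.mem_univ i)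
    have hinj : Function.Injective fun i => e.symm ⟨F i, hmem i⟩ := fun i j h =>
      hF.1 (congrArg Subtype.val (e.symm.injective h))
    refine ⟨Equiv.ofBijective _ (Finite.injective_iff_bijective.1 hinj), by simp, ?_⟩
    funext i
    simp

/-- Enumerating the edges of a hypergraph. -/
theorem factorial_mul_card_kGraphs {k n m : ℕ} (d : Fin n → ℕ) :
    m.factorial * ((kGraphs k n m).filter fun H => degSeq H = fun v => (d v : ℤ)).card =
      ((edgeSeqs (Fin m) k d).filter fun F => Function.Injective F).card := by
  classical
  rw [Finset.card_eq_sum_card_fiberwise (f := fun F => Finset.univ.image F)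
    (t := (kGraphs k n m).filter fun H => degSeq H = fun v => (d v : ℤ))]
  · rw [Finset.sum_congr rfl (g := fun _ => m.factorial), Finset.sum_const, smul_eq_mul, mul_comm]
    intro H hH
    simp only [Finset.mem_filter, kGraphs, Finset.mem_powersetCard] at hH
    rw [← card_injective_image_eq hH.1.2, Finset.filter_filter]
    congr 1
    ext F
    simp only [Finset.mem_filter, Finset.mem_univ, true_and, mem_edgeSeqs]
    refine ⟨fun h => h.2, fun h => ⟨⟨fun i => ?_, fun v => ?_⟩, h⟩⟩
    · have : F i ∈ H := by rw [← h.2]; exact Finset.mem_image_of_mem _ (Finset.mem_univ i)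
      exact (Finset.mem_powersetCard.1 (hH.1.1 this)).2
    · have h1 := congrFun hH.2 v
      simp only [degSeq, Nat.cast_inj] at h1
      rw [← h1, ← h.2, Finset.filter_image, Finset.card_image_of_injective _ h.1]
  · intro F hF
    simp only [Finset.coe_filter, Set.mem_ofPred_eq, mem_edgeSeqs] at hF
    obtain ⟨⟨h1, h2⟩, h3⟩ := hF
    simp only [Finset.coe_filter, Set.mem_ofPred_eq, kGraphs, Finset.mem_powersetCard]
    refine ⟨⟨fun e he => ?_, ?_⟩, ?_⟩
    · obtain ⟨i, -, rfl⟩ := Finset.mem_image.1 he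
      exact Finset.mem_powersetCard.2 ⟨Finset.subset_univ _, h1 i⟩
    · rw [Finset.card_image_of_injective _ h3, Finset.card_univ, Fintype.card_fin]
    · funext v
      simp only [degSeq, Nat.cast_inj]
      rw [← h2 v, Finset.filter_image, Finset.card_image_of_injective _ h3]

end SimpleCount

/-! ### The conditioned binomial law -/

section Binomial

/-- Vandermonde's identity for several summands. -/
theorem sum_piAntidiag_prod_choose {V : Type*} [Fintype V] [DecidableEq V] (N r : ℕ) :
    ∑ x ∈ (Finset.univ : Finset V).piAntidiag r, ∏ v, N.choose (x v) =
      (Fintype.card V * N).choose r := by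
  have h := PowerSeries.coeff_prod (R := ℕ) (fun _ : V => ((1 + Polynomial.X : Polynomial ℕ) ^ N :
    Polynomial ℕ).toPowerSeries) r Finset.univ
  have h1 : ∏ _v : V, ((1 + Polynomial.X : Polynomial ℕ) ^ N : Polynomial ℕ).toPowerSeries =
      ((1 + Polynomial.X : Polynomial ℕ) ^ (Fintype.card V * N) : Polynomial ℕ).toPowerSeries := by
    rw [Finset.prod_const, Finset.card_univ, ← Polynomial.coe_pow, ← pow_mul, mul_comm N]
  rw [h1] at h
  simp only [Polynomial.coeff_coe, Polynomial.coeff_one_add_X_pow, Nat.cast_id] at h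
  rw [h]
  refine Finset.sum_nbij' (fun x => Finsupp.equivFunOnFinite.symm x) (fun l => ⇑l) ?_ ?_ ?_ ?_ ?_
  · intro x hx
    simpa [Finset.mem_finsuppAntidiag, Finset.mem_piAntidiag] using hx
  · intro x hx
    simpa [Finset.mem_finsuppAntidiag, Finset.mem_piAntidiag] using hx
  · intro x _; rfl
  · intro x _; ext; rfl
  · intro x _; rfl

theorem prod_binomial_weight {V : Type*} [Fintype V] (N : ℕ) (p : ℝ) (x : V → ℕ) :
    ∏ v, ((N.choose (x v) : ℝ) * p ^ x v * (1 - p) ^ (N - x v)) =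
      (∏ v, (N.choose (x v) : ℝ)) *
        (p ^ (∑ v, x v) * (1 - p) ^ (Fintype.card V * N - ∑ v, x v)) := by
  by_cases h : ∀ v, x v ≤ N
  · have h1 : Fintype.card V * N - ∑ v, x v = ∑ v, (N - x v) := by
      rw [Finset.sum_tsub_distrib _ fun v _ => h v]
      simp
    rw [h1, Finset.prod_mul_distrib, Finset.prod_mul_distrib, Finset.prod_pow_eq_pow_sum,
      Finset.prod_pow_eq_pow_sum, mul_assoc]
  · push Not at h
    obtain ⟨v, hv⟩ := h
    rw [Finset.prod_eq_zero (Finset.mem_univ v) (by rw [Nat.choose_eq_zero_of_lt hv]; simp),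
      Finset.prod_eq_zero (Finset.mem_univ v) (by rw [Nat.choose_eq_zero_of_lt hv]; simp), zero_mul]

theorem pi_map_natCast_binomial (n N : ℕ) (p : unitInterval) :
    (Measure.pi fun _ : Fin n => (ProbabilityTheory.binomial N p).map (Nat.cast : ℕ → ℤ)) =
      (Measure.pi fun _ : Fin n => ProbabilityTheory.binomial N p).map
        (fun x v => (x v : ℤ)) := by
  rw [Measure.pi_map_pi]
  intro _
  exact (measurable_of_countable _).aemeasurable

theorem pi_binomial_real_singleton (n N : ℕ) (p : unitInterval) (x : Fin n → ℕ) :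
    (Measure.pi fun _ : Fin n => ProbabilityTheory.binomial N p).real {x} =
      (∏ v, (N.choose (x v) : ℝ)) *
        ((p : ℝ) ^ (∑ v, x v) * (1 - (p : ℝ)) ^ (n * N - ∑ v, x v)) := by
  rw [measureReal_def, Measure.pi_singleton, ENNReal.toReal_prod]
  simp only [← measureReal_def, binomial_real_singleton]
  rw [prod_binomial_weight, Fintype.card_fin]

theorem cond_real_apply {Ω : Type*} [MeasurableSpace Ω] {s : Set Ω} (hs : MeasurableSet s)
    (μ : Measure Ω) (t : Set Ω) :
    (ProbabilityTheory.cond μ s).real t = (μ.real s)⁻¹ * μ.real (s ∩ t) := by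
  rw [measureReal_def, cond_apply hs, ENNReal.toReal_mul, ENNReal.toReal_inv, ← measureReal_def,
    ← measureReal_def]

/-- The conditioned binomial law in closed form. -/
theorem probB_natCast {k n m : ℕ} {p : unitInterval} (hp0 : 0 < p) (hp1 : p < 1) {d : Fin n → ℕ}
    (hs : ∑ v, d v = k * m) :
    probB k n m p (fun v => (d v : ℤ)) =
      (∏ v, (((n - 1).choose (k - 1)).choose (d v) : ℝ)) /
        ((n * (n - 1).choose (k - 1)).choose (k * m) : ℝ) := by
  set N := (n - 1).choose (k - 1)
  set ν : Measure (Fin n → ℕ) := Measure.pi fun _ : Fin n => ProbabilityTheory.binomial N p with hν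
  set w : ℝ := (p : ℝ) ^ (k * m) * (1 - (p : ℝ)) ^ (n * N - k * m) with hw
  have hw0 : w ≠ 0 := by
    have h1 : (0 : ℝ) < p := hp0
    have h2 : (p : ℝ) < 1 := hp1
    have h3 : (0 : ℝ) < 1 - p := by linarith
    positivity
  have hmeas : Measurable (fun (x : Fin n → ℕ) (v : Fin n) => (x v : ℤ)) := by
    refine measurable_pi_lambda _ fun v => ?_
    exact (measurable_of_countable _).comp (measurable_pi_apply v)
  have hΩ : MeasurableSet (Omega k n m) := (Set.to_countable _).measurableSet
  have hd : (fun v => (d v : ℤ)) ∈ Omega k n m := by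
    simp only [Omega, Set.mem_ofPred_eq]
    exact_mod_cast hs
  have hinter : Omega k n m ∩ {fun v => (d v : ℤ)} = {fun v => (d v : ℤ)} := by
    rw [Set.inter_eq_right]; simpa using hd
  have h1 : (ν.map (fun x v => (x v : ℤ))).real {fun v => (d v : ℤ)} =
      (∏ v, (N.choose (d v) : ℝ)) * w := by
    rw [map_measureReal_apply hmeas (Set.to_countable _).measurableSet]
    have : (fun (x : Fin n → ℕ) (v : Fin n) => (x v : ℤ)) ⁻¹' {fun v => (d v : ℤ)} = {d} := by
      ext x
      simp [funext_iff]
    rw [this, pi_binomial_real_singleton, hs]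
  have h2 : (ν.map (fun x v => (x v : ℤ))).real (Omega k n m) =
      ((n * N).choose (k * m) : ℝ) * w := by
    rw [map_measureReal_apply hmeas hΩ]
    have : (fun (x : Fin n → ℕ) (v : Fin n) => (x v : ℤ)) ⁻¹' Omega k n m =
        ((Finset.univ : Finset (Fin n)).piAntidiag (k * m) : Set (Fin n → ℕ)) := by
      ext x
      simp only [Omega, Set.mem_preimage, Set.mem_ofPred_eq, Finset.mem_coe,
        Finset.mem_piAntidiag, Finset.mem_univ, implies_true, and_true]
      norm_cast
    rw [this, ← sum_measureReal_singleton]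
    rw [Finset.sum_congr rfl (g := fun x => ((∏ v, N.choose (x v) : ℕ) : ℝ) * w)]
    · rw [← Finset.sum_mul, ← Nat.cast_sum, sum_piAntidiag_prod_choose, Fintype.card_fin]
    · intro x hx
      rw [Finset.mem_piAntidiag] at hx
      rw [pi_binomial_real_singleton, hx.1]
      push_cast
      rfl
  rw [probB, lawB, pi_map_natCast_binomial, cond_real_apply hΩ, hinter, h1, h2]
  rw [← div_eq_inv_mul, mul_div_mul_right _ _ hw0]

theorem probB_of_neg {k n m : ℕ} {p : unitInterval} {d : Fin n → ℤ} {v : Fin n} (hv : d v < 0) :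
    probB k n m p d = 0 := by
  have hΩ : MeasurableSet (Omega k n m) := (Set.to_countable _).measurableSet
  have hmeas : Measurable (fun (x : Fin n → ℕ) (v : Fin n) => (x v : ℤ)) := by
    refine measurable_pi_lambda _ fun v => ?_
    exact (measurable_of_countable _).comp (measurable_pi_apply v)
  rw [probB, lawB, pi_map_natCast_binomial, cond_real_apply hΩ,
    map_measureReal_apply hmeas (s := Omega k n m ∩ {d}) (Set.to_countable _).measurableSet]
  have : (fun (x : Fin n → ℕ) (v : Fin n) => (x v : ℤ)) ⁻¹' (Omega k n m ∩ {d}) = ∅ := by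
    rw [Set.eq_empty_iff_forall_notMem]
    rintro x ⟨-, hx⟩
    have := congrFun (Set.mem_singleton_iff.1 hx) v
    simp only at this
    omega
  rw [this]
  simp

theorem probD_of_neg {k n m : ℕ} {d : Fin n → ℤ} {v : Fin n} (hv : d v < 0) :
    probD k n m d = 0 := by
  have : (kGraphs k n m).filter (fun H => degSeq H = d) = ∅ := by
    rw [Finset.filter_eq_empty_iff]
    intro H _ h
    have := congrFun h v
    simp only [degSeq] at this
    omega
  simp [probD, this]

theorem card_kGraphs (k n m : ℕ) : (kGraphs k n m).card = (n.choose k).choose m := by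
  simp [kGraphs, Finset.card_powersetCard]

end Binomial

/-! ### Comparing the normalizing factors -/

section Estimates

theorem div_pow_le_choose {n k : ℕ} (hk : 1 ≤ k) (hkn : k ≤ n) :
    ((n : ℝ) / k) ^ k ≤ n.choose k := by
  have h1 : n ^ k * k.factorial ≤ k ^ k * n.descFactorial k := by
    have hpow : ∀ x : ℕ, x ^ k = ∏ _i ∈ Finset.range k, x := fun x => by simp
    rw [← Nat.descFactorial_self k, Nat.descFactorial_eq_prod_range,
      Nat.descFactorial_eq_prod_range, hpow, hpow, ← Finset.prod_mul_distrib,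
      ← Finset.prod_mul_distrib]
    refine Finset.prod_le_prod' fun i hi => ?_
    rw [Finset.mem_range] at hi
    obtain ⟨a, rfl⟩ := Nat.exists_eq_add_of_lt hi
    obtain ⟨b, rfl⟩ := Nat.exists_eq_add_of_le hkn
    rw [show i + a + 1 - i = a + 1 by omega, show i + a + 1 + b - i = a + 1 + b by omega]
    nlinarith
  rw [Nat.descFactorial_eq_factorial_mul_choose] at h1
  have h2 : n ^ k ≤ k ^ k * n.choose k := by
    refine Nat.le_of_mul_le_mul_right (h1.trans (le_of_eq ?_)) (Nat.factorial_pos k)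
    ring
  have hk0 : (0 : ℝ) < k := by exact_mod_cast hk
  rw [div_pow, div_le_iff₀ (by positivity), mul_comm]
  exact_mod_cast h2

theorem exp_neg_add_sq_le_one_sub {x : ℝ} (h0 : 0 ≤ x) (h1 : x ≤ 1 / 2) :
    Real.exp (-(x + x ^ 2)) ≤ 1 - x := by
  have h2 : 0 < 1 - x := by linarith
  have h3 := Real.quadratic_le_exp_of_nonneg (x := x + x ^ 2) (by positivity)
  rw [Real.exp_neg, inv_le_comm₀ (Real.exp_pos _) h2, inv_le_iff_one_le_mul₀ h2]
  have h4 : 1 ≤ (1 + (x + x ^ 2) + (x + x ^ 2) ^ 2 / 2) * (1 - x) := by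
    have : (1 + (x + x ^ 2) + (x + x ^ 2) ^ 2 / 2) * (1 - x) - 1 =
        x ^ 2 * ((1 - x - x ^ 2 * (1 + x)) / 2) := by ring
    have h5 : 0 ≤ (1 - x - x ^ 2 * (1 + x)) / 2 := by nlinarith
    nlinarith [mul_nonneg (sq_nonneg x) h5]
  nlinarith

/-- A falling factorial to second order: the main term is `r (r - 1) / (2 n)`. -/
theorem descFactorial_bounds {n r : ℕ} (hr : 2 * r ≤ n) (hn : 0 < n) :
    (n : ℝ) ^ r * Real.exp (-((r : ℝ) * (r - 1) / (2 * n) + (r : ℝ) ^ 3 / n ^ 2)) ≤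
        n.descFactorial r ∧
      (n.descFactorial r : ℝ) ≤ (n : ℝ) ^ r * Real.exp (-((r : ℝ) * (r - 1) / (2 * n))) := by
  have hn' : (0 : ℝ) < n := by exact_mod_cast hn
  have hsum : ∑ i ∈ Finset.range r, (i : ℝ) / n = (r : ℝ) * (r - 1) / (2 * n) := by
    have h : (∑ i ∈ Finset.range r, (i : ℝ)) = r * (r - 1) / 2 := by
      clear hr
      induction r with
      | zero => simp
      | succ r ih => rw [Finset.sum_range_succ, ih]; push_cast; ring
    rw [← Finset.sum_div, h]
    field_simp
  have hsq : ∑ i ∈ Finset.range r, ((i : ℝ) / n) ^ 2 ≤ (r : ℝ) ^ 3 / n ^ 2 := by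
    refine (Finset.sum_le_card_nsmul _ _ ((r : ℝ) ^ 2 / n ^ 2) fun i hi => ?_).trans (le_of_eq ?_)
    · rw [div_pow]
      have : (i : ℝ) ≤ r := by exact_mod_cast (Finset.mem_range.1 hi).le
      gcongr
    · rw [Finset.card_range, nsmul_eq_mul]; ring
  rw [descFactorial_eq_pow_mul_prod (by omega) hn]
  have hsmall : ∀ i ∈ Finset.range r, (i : ℝ) / n ≤ 1 / 2 := fun i hi => by
    rw [Finset.mem_range] at hi
    rw [div_le_iff₀ hn']
    have : (2 : ℝ) * i ≤ n := by exact_mod_cast (by omega : 2 * i ≤ n)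
    linarith
  constructor
  · refine mul_le_mul_of_nonneg_left ?_ (by positivity)
    calc Real.exp (-((r : ℝ) * (r - 1) / (2 * n) + (r : ℝ) ^ 3 / n ^ 2))
        ≤ Real.exp (∑ i ∈ Finset.range r, -((i : ℝ) / n + ((i : ℝ) / n) ^ 2)) := by
          rw [Real.exp_le_exp, Finset.sum_neg_distrib, neg_le_neg_iff, Finset.sum_add_distrib, hsum]
          gcongr
      _ ≤ _ := by
          rw [Real.exp_sum]
          exact Finset.prod_le_prod (fun i _ => (Real.exp_pos _).le) fun i hi =>
            exp_neg_add_sq_le_one_sub (by positivity) (hsmall i hi)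
  · refine mul_le_mul_of_nonneg_left ?_ (by positivity)
    calc ∏ i ∈ Finset.range r, (1 - (i : ℝ) / n)
        ≤ Real.exp (∑ i ∈ Finset.range r, -((i : ℝ) / n)) := by
          rw [Real.exp_sum]
          exact Finset.prod_le_prod (fun i hi => by linarith [hsmall i hi]) fun i _ =>
            Real.one_sub_le_exp_neg _
      _ = _ := by rw [Finset.sum_neg_distrib, hsum]

theorem mul_choose_pred {n k : ℕ} (hk : 1 ≤ k) (hn : 1 ≤ n) :
    n * (n - 1).choose (k - 1) = k * n.choose k := by
  obtain ⟨a, rfl⟩ := Nat.exists_eq_add_of_le' hn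
  obtain ⟨b, rfl⟩ := Nat.exists_eq_add_of_le' hk
  simpa [mul_comm] using Nat.add_one_mul_choose_eq a b

/-- The conditioned binomial probability of `d`, divided by
`configWeight k m d / (n.choose k).descFactorial m`, written as a quotient of falling factorials. -/
noncomputable def weightRatio (k m : ℕ) {n : ℕ} (d : Fin n → ℕ) : ℝ :=
  (∏ v, (((n - 1).choose (k - 1)).descFactorial (d v) : ℝ)) *
      (((n.choose k).descFactorial m : ℝ) * (k.factorial : ℝ) ^ m) /
    ((k * n.choose k).descFactorial (k * m) : ℝ)

variable {k n m D : ℕ} {d : Fin n → ℕ}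

theorem mul_le_mul_of_sum_eq (hs : ∑ v, d v = k * m) (hD : ∀ v, d v ≤ D) : k * m ≤ n * D := by
  rw [← hs]
  refine (Finset.sum_le_card_nsmul _ _ D fun v _ => hD v).trans ?_
  simp

/-- In the sparse range `n.choose k` dominates the powers of `m / D` that occur in the error terms,
because `m / D ≤ n / k`. -/
theorem sparse_sizes (hk : 3 ≤ k) (hD1 : 1 ≤ D) (hm : 32 * D ≤ m) (hDm : D ^ 2 ≤ m)
    (hn : k * m ≤ n * D) :
    32 * k ≤ n ∧ ((m : ℝ) / D) ^ k ≤ n.choose k ∧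
      (n : ℝ) / k * ((m : ℝ) / D) ^ (k - 1) ≤ n.choose k ∧
      2 * m ≤ n.choose k ∧ 2 * D ≤ (n - 1).choose (k - 1) := by
  have hkn : 32 * k ≤ n := by
    refine Nat.le_of_mul_le_mul_right ?_ (show 0 < D by omega)
    calc 32 * k * D = k * (32 * D) := by ring
      _ ≤ k * m := Nat.mul_le_mul_left _ hm
      _ ≤ n * D := hn
  have hDr : (1 : ℝ) ≤ D := by exact_mod_cast hD1
  have hkr : (3 : ℝ) ≤ k := by exact_mod_cast hk
  have hmr : (32 : ℝ) * D ≤ m := by exact_mod_cast hm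
  have hDmr : (D : ℝ) ^ 2 ≤ m := by exact_mod_cast hDm
  have hnr : (k : ℝ) * m ≤ n * D := by exact_mod_cast hn
  have ht : (m : ℝ) / D ≤ n / k := by
    rw [div_le_div_iff₀ (by linarith) (by linarith)]
    linarith
  have ht1 : 1 ≤ (m : ℝ) / D := by
    rw [le_div_iff₀ (by linarith)]; linarith
  have ht0 : 0 ≤ (m : ℝ) / D := by linarith
  have hc := div_pow_le_choose (n := n) (k := k) (by omega) (by omega)
  have h2 : (n : ℝ) / k * ((m : ℝ) / D) ^ (k - 1) ≤ n.choose k := by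
    refine le_trans ?_ hc
    obtain ⟨j, hj⟩ : ∃ j, k = j + 1 := ⟨k - 1, by omega⟩
    rw [show (((n : ℝ) / k) ^ k) = (n : ℝ) / k * ((n : ℝ) / k) ^ (k - 1) by
      rw [← pow_succ']; congr 1; omega]
    have := pow_le_pow_left₀ ht0 ht (k - 1)
    gcongr
  have h1 : ((m : ℝ) / D) ^ k ≤ n.choose k := (pow_le_pow_left₀ ht0 ht k).trans hc
  have hm2 : 2 * (D : ℝ) ^ 3 ≤ m ^ 2 := by
    have : (D : ℝ) ^ 2 * (32 * D) ≤ m * m := mul_le_mul hDmr hmr (by positivity) (by positivity)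
    nlinarith
  refine ⟨hkn, h1, h2, ?_, ?_⟩
  · have : (2 : ℝ) * m ≤ n.choose k := by
      refine le_trans ?_ ((pow_le_pow_right₀ ht1 hk).trans h1)
      rw [div_pow, le_div_iff₀ (by positivity)]
      nlinarith
    exact_mod_cast this
  · have hN := mul_choose_pred (n := n) (k := k) (by omega) (by omega)
    have hN' : (n : ℝ) * ((n - 1).choose (k - 1) : ℝ) = k * n.choose k := by exact_mod_cast hN
    have hn0 : (0 : ℝ) < n := by exact_mod_cast (by omega : 0 < n)
    have : (2 : ℝ) * D ≤ (n - 1).choose (k - 1) := by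
      refine le_of_mul_le_mul_left ?_ hn0
      rw [hN']
      calc (n : ℝ) * (2 * D) ≤ n * ((m : ℝ) / D) ^ 2 := by
            refine mul_le_mul_of_nonneg_left ?_ hn0.le
            rw [div_pow, le_div_iff₀ (by positivity)]
            nlinarith
        _ ≤ n * ((m : ℝ) / D) ^ (k - 1) := by
            refine mul_le_mul_of_nonneg_left (pow_le_pow_right₀ ht1 (by omega)) hn0.le
        _ = k * ((n : ℝ) / k * ((m : ℝ) / D) ^ (k - 1)) := by field_simp
        _ ≤ _ := by gcongr
    exact_mod_cast this

/-- Combining bounds for the factors of `weightRatio`; quantities with index `0` are the powers that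
replace falling factorials. -/
theorem exp_bounds_of_factor_bounds {A B C A₀ B₀ C₀ f P F Y z κ ρ : ℝ} (hC₀ : 0 < C₀) (hP : 0 < P)
    (hf : 0 ≤ f) (hA₀ : 0 ≤ A₀) (hB₀ : 0 ≤ B₀)
    (hA1 : A₀ * Real.exp (-ρ) ≤ A) (hA2 : A ≤ A₀) (hB1 : B₀ * Real.exp (-ρ) ≤ B) (hB2 : B ≤ B₀)
    (hC1 : C₀ * Real.exp (-ρ) ≤ C) (hC2 : C ≤ C₀) (hbase : A₀ * (B₀ * f) * P = C₀ * F)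
    (hF1 : P * Real.exp (-(Y + z)) ≤ F) (hF2 : F ≤ P * Real.exp (-Y)) (hz : z ≤ κ) :
    Real.exp (-(Y + κ + 2 * ρ)) ≤ A * (B * f) / C ∧
      A * (B * f) / C ≤ Real.exp (-(Y - ρ)) := by
  have hC : 0 < C := lt_of_lt_of_le (by positivity) hC1
  have hA : 0 ≤ A := le_trans (by positivity) hA1
  have hB : 0 ≤ B := le_trans (by positivity) hB1
  constructor
  · rw [le_div_iff₀ hC]
    refine le_of_mul_le_mul_right ?_ hP
    calc Real.exp (-(Y + κ + 2 * ρ)) * C * P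
        ≤ Real.exp (-(Y + z + 2 * ρ)) * C₀ * P := by gcongr
      _ = C₀ * (P * Real.exp (-(Y + z))) * (Real.exp (-ρ) * Real.exp (-ρ)) := by
          rw [show -(Y + z + 2 * ρ) = -(Y + z) + (-ρ + -ρ) by ring, Real.exp_add, Real.exp_add]
          ring
      _ ≤ C₀ * F * (Real.exp (-ρ) * Real.exp (-ρ)) := by gcongr
      _ = (A₀ * Real.exp (-ρ)) * ((B₀ * Real.exp (-ρ)) * f) * P := by rw [← hbase]; ring
      _ ≤ A * (B * f) * P := by gcongr
  · rw [div_le_iff₀ hC]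
    refine le_of_mul_le_mul_right ?_ hP
    calc A * (B * f) * P ≤ A₀ * (B₀ * f) * P := by gcongr
      _ = C₀ * F := hbase
      _ ≤ C₀ * (P * Real.exp (-Y)) := by gcongr
      _ = Real.exp (-(Y - ρ)) * (C₀ * Real.exp (-ρ)) * P := by
          rw [show -Y = -(Y - ρ) + -ρ by ring, Real.exp_add]; ring
      _ ≤ Real.exp (-(Y - ρ)) * C * P := by gcongr

/-- The falling factorials in `weightRatio` may be replaced by powers, except for those coming from
`(n.choose k) * k! = n.descFactorial k`, which contribute the factor `exp (-(k - 1) k m / (2 n))`. -/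
theorem weightRatio_bounds (hk : 3 ≤ k) (hD1 : 1 ≤ D) (hm : 32 * D ≤ m) (hDm : D ^ 2 ≤ m)
    (hs : ∑ v, d v = k * m) (hD : ∀ v, d v ≤ D) :
    Real.exp (-(((k : ℝ) - 1) * (k * m) / (2 * n) + (k * D ^ 2 / m : ℝ) +
        2 * (k * m ^ 2 * ((D : ℝ) / m) ^ k))) ≤ weightRatio k m d ∧
      weightRatio k m d ≤ Real.exp (-(((k : ℝ) - 1) * (k * m) / (2 * n) -
        k * m ^ 2 * ((D : ℝ) / m) ^ k)) := by
  have hn := mul_le_mul_of_sum_eq hs hD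
  obtain ⟨hkn, hN1, hN2, hN3, hN4⟩ := sparse_sizes hk hD1 hm hDm hn
  have hNN := mul_choose_pred (n := n) (k := k) (by omega) (by omega)
  obtain ⟨low, up⟩ := descFactorial_bounds (n := n) (r := k) (by omega) (by omega)
  unfold weightRatio
  have hnk : (n.descFactorial k : ℝ) = k.factorial * n.choose k := by
    exact_mod_cast Nat.descFactorial_eq_factorial_mul_choose n k
  set N := n.choose k with hNdef
  set N' := (n - 1).choose (k - 1) with hN'def
  have hDr : (1 : ℝ) ≤ D := by exact_mod_cast hD1
  have hkr : (3 : ℝ) ≤ k := by exact_mod_cast hk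
  have hmr : (32 : ℝ) * D ≤ m := by exact_mod_cast hm
  have hnr : (k : ℝ) * m ≤ n * D := by exact_mod_cast hn
  have hm0 : (0 : ℝ) < m := by linarith
  have hn0 : (0 : ℝ) < n := by exact_mod_cast (by omega : 0 < n)
  have hNpos : 0 < N := by omega
  have hN0 : (0 : ℝ) < N := by exact_mod_cast hNpos
  have hN'pos : 0 < N' := by omega
  have hN'0 : (0 : ℝ) < N' := by exact_mod_cast hN'pos
  have hNNr : (n : ℝ) * N' = k * N := by exact_mod_cast hNN
  set ρ : ℝ := k * m ^ 2 * ((D : ℝ) / m) ^ k with hρ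
  have hDm1 : ((D : ℝ) / m) ^ k * ((m : ℝ) / D) ^ k = 1 := by
    rw [← mul_pow, div_mul_div_cancel₀ (by positivity), div_self (by positivity), one_pow]
  -- the quadratic error terms of the three kinds of falling factorials are all at most `ρ`
  have hb : (k : ℝ) * m ^ 2 / N ≤ ρ := by
    rw [div_le_iff₀ hN0, hρ, mul_assoc]
    refine le_mul_of_one_le_right (by positivity) ?_
    rw [← hDm1]
    gcongr
  have ha : (D : ℝ) * (k * m) / N' ≤ ρ := by
    rw [div_le_iff₀ hN'0]
    have e1 : (N' : ℝ) = k * N / n := by rw [← hNNr]; field_simp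
    have e2 : ρ * N' = k * m ^ 2 * ((D : ℝ) / m) ^ k * (k * N / n) := by rw [hρ, e1]
    have e3 : ((m : ℝ) / D) ^ k = (m : ℝ) / D * ((m : ℝ) / D) ^ (k - 1) := by
      rw [← pow_succ']; congr 1; omega
    rw [e2]
    calc (D : ℝ) * (k * m) = k * m ^ 2 * ((D : ℝ) / m) ^ k *
          (k * ((n : ℝ) / k * ((m : ℝ) / D) ^ (k - 1)) / n) := by
          rw [e3] at hDm1
          have : (D : ℝ) / m * ((m : ℝ) / D) = 1 := by field_simp
          calc (D : ℝ) * (k * m) = k * m ^ 2 * (D / m) := by field_simp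
            _ = k * m ^ 2 * (D / m) *
                (((D : ℝ) / m) ^ k * ((m : ℝ) / D * ((m : ℝ) / D) ^ (k - 1))) := by
                rw [hDm1, mul_one]
            _ = k * m ^ 2 * ((D : ℝ) / m) ^ k * ((m : ℝ) / D) ^ (k - 1) *
                ((D : ℝ) / m * ((m : ℝ) / D)) := by ring
            _ = _ := by rw [this]; field_simp
      _ ≤ _ := by gcongr
  have hκ : (m : ℝ) * (k ^ 3 / n ^ 2) ≤ k * D ^ 2 / m := by
    rw [← mul_div_assoc, div_le_div_iff₀ (by positivity) hm0]
    have : ((k : ℝ) * m) ^ 2 ≤ (n * D) ^ 2 := pow_le_pow_left₀ (by positivity) hnr 2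
    nlinarith
  have hA2 : ∏ v, (N'.descFactorial (d v) : ℝ) ≤ (N' : ℝ) ^ (k * m) := by
    rw [← hs, ← Finset.prod_pow_eq_pow_sum]
    exact Finset.prod_le_prod (fun _ _ => Nat.cast_nonneg _) fun v _ =>
      descFactorial_le_pow_real _ _
  have hA1 : (N' : ℝ) ^ (k * m) * Real.exp (-ρ) ≤ ∏ v, (N'.descFactorial (d v) : ℝ) := by
    calc (N' : ℝ) ^ (k * m) * Real.exp (-ρ)
        ≤ (N' : ℝ) ^ (k * m) * Real.exp (∑ v, -((d v : ℝ) ^ 2 / N')) := by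
          refine mul_le_mul_of_nonneg_left (Real.exp_le_exp.2 ?_) (by positivity)
          rw [Finset.sum_neg_distrib, neg_le_neg_iff, ← Finset.sum_div]
          refine le_trans (div_le_div_of_nonneg_right ?_ hN'0.le) ha
          have : ((k : ℝ) * m) = ∑ v, (d v : ℝ) := by exact_mod_cast hs.symm
          rw [this, Finset.mul_sum]
          refine Finset.sum_le_sum fun v _ => ?_
          have : (d v : ℝ) ≤ D := by exact_mod_cast hD v
          rw [sq]
          gcongr
      _ = ∏ v, ((N' : ℝ) ^ d v * Real.exp (-((d v : ℝ) ^ 2 / N'))) := by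
          rw [Finset.prod_mul_distrib, Real.exp_sum, Finset.prod_pow_eq_pow_sum, hs]
      _ ≤ _ := Finset.prod_le_prod (fun _ _ => by positivity) fun v _ =>
          le_descFactorial (by have := hD v; omega) hN'pos
  have hB2 := descFactorial_le_pow_real N m
  have hB1 : (N : ℝ) ^ m * Real.exp (-ρ) ≤ (N.descFactorial m : ℝ) := by
    refine le_trans ?_ (le_descFactorial hN3 hNpos)
    refine mul_le_mul_of_nonneg_left (Real.exp_le_exp.2 (neg_le_neg ?_)) (by positivity)
    refine le_trans (div_le_div_of_nonneg_right ?_ hN0.le) hb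
    nlinarith [sq_nonneg (m : ℝ)]
  have hC2 := descFactorial_le_pow_real (k * N) (k * m)
  have hC1 : ((k * N : ℕ) : ℝ) ^ (k * m) * Real.exp (-ρ) ≤ ((k * N).descFactorial (k * m) : ℝ) := by
    refine le_trans ?_ (le_descFactorial (by nlinarith) (by positivity))
    refine mul_le_mul_of_nonneg_left (Real.exp_le_exp.2 (neg_le_neg ?_)) (by positivity)
    refine le_trans (le_of_eq ?_) hb
    push_cast
    field_simp
  have hCpos : (0 : ℝ) < ((k * N).descFactorial (k * m) : ℝ) :=
    lt_of_lt_of_le (by positivity) hC1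
  have hbase : (N' : ℝ) ^ (k * m) * ((N : ℝ) ^ m * (k.factorial : ℝ) ^ m) * ((n : ℝ) ^ k) ^ m =
      ((k * N : ℕ) : ℝ) ^ (k * m) * (n.descFactorial k : ℝ) ^ m := by
    rw [hnk, mul_pow, Nat.cast_mul, ← hNNr, mul_pow, ← pow_mul]
    ring
  have hY : Real.exp (-((k : ℝ) * (k - 1) / (2 * n))) ^ m =
      Real.exp (-(((k : ℝ) - 1) * (k * m) / (2 * n))) := by
    rw [← Real.exp_nat_mul]; congr 1; field_simp
  have hY' : Real.exp (-((k : ℝ) * (k - 1) / (2 * n) + (k : ℝ) ^ 3 / n ^ 2)) ^ m =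
      Real.exp (-(((k : ℝ) - 1) * (k * m) / (2 * n) + m * (k ^ 3 / n ^ 2))) := by
    rw [← Real.exp_nat_mul]; congr 1; field_simp
  have hnp : (0 : ℝ) < ((n : ℝ) ^ k) ^ m := by positivity
  have hup' : (n.descFactorial k : ℝ) ^ m ≤
      ((n : ℝ) ^ k) ^ m * Real.exp (-(((k : ℝ) - 1) * (k * m) / (2 * n))) := by
    rw [← hY, ← mul_pow]
    exact pow_le_pow_left₀ (Nat.cast_nonneg _) up m
  have hlow' : ((n : ℝ) ^ k) ^ m *
      Real.exp (-(((k : ℝ) - 1) * (k * m) / (2 * n) + m * (k ^ 3 / n ^ 2))) ≤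
      (n.descFactorial k : ℝ) ^ m := by
    rw [← hY', ← mul_pow]
    exact pow_le_pow_left₀ (by positivity) low m
  set A := ∏ v, (N'.descFactorial (d v) : ℝ)
  set B := (N.descFactorial m : ℝ)
  set C := ((k * N).descFactorial (k * m) : ℝ)
  set Y := ((k : ℝ) - 1) * (k * m) / (2 * n)
  set C0 := ((k * N : ℕ) : ℝ) ^ (k * m)
  have hC00 : 0 < C0 := by
    have : (0 : ℝ) < (k * N : ℕ) := by positivity
    positivity
  have hA0 : 0 ≤ A := Finset.prod_nonneg fun _ _ => Nat.cast_nonneg _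
  exact exp_bounds_of_factor_bounds hC00 hnp (by positivity) (by positivity) (by positivity)
    hA1 hA2 hB1 hB2 hC1 hC2 hbase hlow' hup' hκ

end Estimates

/-! ### The approximation and its error -/

section Assembly

variable {k n m D : ℕ} {d : Fin n → ℕ}

theorem probD_natCast :
    probD k n m (fun v => (d v : ℤ)) =
      (((edgeSeqs (Fin m) k d).filter fun F => Function.Injective F).card : ℝ) /
        ((n.choose k).descFactorial m : ℝ) := by
  rw [probD, card_kGraphs, Nat.descFactorial_eq_factorial_mul_choose, ← factorial_mul_card_kGraphs]
  push_cast
  rw [mul_div_mul_left _ _ (by exact_mod_cast Nat.factorial_ne_zero m)]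

theorem probB_mul_descFactorial {p : unitInterval} (hp0 : 0 < p) (hp1 : p < 1) (hk : 1 ≤ k)
    (hn : 1 ≤ n) (hm : m ≤ n.choose k) (hs : ∑ v, d v = k * m) :
    probB k n m p (fun v => (d v : ℤ)) * ((n.choose k).descFactorial m : ℝ) =
      configWeight k m d * weightRatio k m d := by
  rw [probB_natCast hp0 hp1 hs, mul_choose_pred hk hn]
  have h1 : ∏ v, (((n - 1).choose (k - 1)).descFactorial (d v) : ℝ) =
      (∏ v, ((d v).factorial : ℝ)) * ∏ v, (((n - 1).choose (k - 1)).choose (d v) : ℝ) := by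
    rw [← Finset.prod_mul_distrib]
    refine Finset.prod_congr rfl fun v _ => ?_
    exact_mod_cast Nat.descFactorial_eq_factorial_mul_choose _ _
  have h2 : ((k * n.choose k).descFactorial (k * m) : ℝ) =
      ((k * m).factorial : ℝ) * ((k * n.choose k).choose (k * m) : ℝ) := by
    exact_mod_cast Nat.descFactorial_eq_factorial_mul_choose _ _
  have h3 : ((k * n.choose k).choose (k * m) : ℝ) ≠ 0 := by
    exact_mod_cast (Nat.choose_pos (Nat.mul_le_mul_left k hm)).ne'
  have h4 : ∏ v, ((d v).factorial : ℝ) ≠ 0 :=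
    Finset.prod_ne_zero_iff.2 fun v _ => by exact_mod_cast Nat.factorial_ne_zero _
  have h5 : ((k * m).factorial : ℝ) ≠ 0 := by exact_mod_cast Nat.factorial_ne_zero _
  have h6 : (k.factorial : ℝ) ≠ 0 := by exact_mod_cast Nat.factorial_ne_zero _
  unfold configWeight weightRatio
  rw [h1, h2]
  field_simp

/-- The exponent of the correction factor is `-loopMean` up to a term that depends on the average
degree only. -/
theorem exponent_add_loopMean (hk : 1 ≤ k) (hm : 1 ≤ m) (hn : 1 ≤ n) (hs : ∑ v, d v = k * m) :
    (((k : ℝ) - 1) / 2) *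
        (1 - (n : ℝ) * sigmaSq (fun v => (d v : ℤ)) / ((k : ℝ) * m)) + loopMean k m d =
      ((k : ℝ) - 1) * (k * m) / (2 * n) := by
  have hk0 : (k : ℝ) ≠ 0 := by positivity
  have hm0 : (m : ℝ) ≠ 0 := by positivity
  have hn0 : (n : ℝ) ≠ 0 := by positivity
  have hsr : ∑ v, (d v : ℝ) = k * m := by exact_mod_cast hs
  have h1 : (n : ℝ) * sigmaSq (fun v => (d v : ℤ)) =
      ∑ v, (d v : ℝ) ^ 2 - ((k : ℝ) * m) ^ 2 / n := by
    unfold sigmaSq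
    simp only [Int.cast_natCast]
    rw [hsr, ← mul_assoc, mul_one_div_cancel hn0, one_mul]
    simp only [sub_sq]
    rw [Finset.sum_add_distrib, Finset.sum_sub_distrib, ← Finset.sum_mul, ← Finset.mul_sum, hsr,
      Finset.sum_const, Finset.card_univ, Fintype.card_fin, nsmul_eq_mul]
    field_simp
    ring
  have h2 : ∑ v, (d v : ℝ) * ((d v : ℝ) - 1) = ∑ v, (d v : ℝ) ^ 2 - k * m := by
    rw [← hsr, ← Finset.sum_sub_distrib]
    exact Finset.sum_congr rfl fun v _ => by ring
  unfold loopMean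
  rw [h1, h2]
  field_simp
  ring

/-- The approximation of `probD` by the corrected conditioned binomial law, with error
`E = k * D ^ 2 / m + k * m ^ 2 * (D / m) ^ k`. -/
theorem probD_bounds {p : unitInterval} (hp0 : 0 < p) (hp1 : p < 1) (hk : 3 ≤ k) (hD1 : 1 ≤ D)
    (hm : 32 * D ≤ m) (hDm : D ^ 2 ≤ m) (hkm : k ≤ m) (hkD : k * D ^ 2 ≤ 3 * m)
    (hs : ∑ v, d v = k * m) (hD : ∀ v, d v ≤ D) {E G : ℝ}
    (hE : E = k * D ^ 2 / m + k * m ^ 2 * ((D : ℝ) / m) ^ k)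
    (hG : G = probB k n m p (fun v => (d v : ℤ)) * Real.exp ((((k : ℝ) - 1) / 2) *
        (1 - (n : ℝ) * sigmaSq (fun v => (d v : ℤ)) / ((k : ℝ) * m)))) :
    0 < G ∧ probD k n m (fun v => (d v : ℤ)) ≤ G * Real.exp (5 * E) ∧
      (Real.exp 46 * E ≤ 1 →
        G * ((1 - Real.exp 46 * E) * Real.exp (-(4 * E))) ≤ probD k n m (fun v => (d v : ℤ))) := by
  have hn := mul_le_mul_of_sum_eq hs hD
  obtain ⟨hkn, -, -, hN, -⟩ := sparse_sizes hk hD1 hm hDm hn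
  obtain ⟨r1, r2⟩ := weightRatio_bounds hk hD1 hm hDm hs hD
  have bnd := card_edgeSeqs_bounds (ι := Fin m) (k := k) (D := D) (d := d) (by omega) hD1
    (by rw [Fintype.card_fin]; omega) (by rw [Fintype.card_fin]; exact hs) hD
  have inj := card_edgeSeqs_le_add_card_injective (ι := Fin m) (k := k) (D := D) (d := d)
    (by omega) hD1 (by rw [Fintype.card_fin]; omega) (by rw [Fintype.card_fin]; exact hs) hD
    (by rw [Fintype.card_fin]; omega) (by rw [Fintype.card_fin]; omega)
  have hle := Finset.card_filter_le (edgeSeqs (Fin m) k d) fun F => Function.Injective F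
  have hB := probB_mul_descFactorial (d := d) hp0 hp1 (k := k) (n := n) (m := m) (by omega)
    (by omega) (by omega) hs
  have hexp := exponent_add_loopMean (d := d) (k := k) (m := m) (n := n) (by omega) (by omega)
    (by omega) hs
  have hL := loopMean_le (by omega : 1 ≤ k) (by omega : 1 ≤ m) hs hD
  have hW := configWeight_pos k m d
  have hT : (0 : ℝ) < ((n.choose k).descFactorial m : ℝ) := by
    exact_mod_cast Nat.pos_of_ne_zero fun h => by
      rw [Nat.descFactorial_eq_zero_iff_lt] at h; omega
  rw [Fintype.card_fin] at bnd inj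
  rw [probD_natCast]
  have hle' : ((((edgeSeqs (Fin m) k d).filter fun F => Function.Injective F).card : ℕ) : ℝ) ≤
      (edgeSeqs (Fin m) k d).card := by exact_mod_cast hle
  have hkr : (3 : ℝ) ≤ k := by exact_mod_cast hk
  have hDr : (1 : ℝ) ≤ D := by exact_mod_cast hD1
  have hm0 : (0 : ℝ) < m := by exact_mod_cast (by omega : 0 < m)
  have hκ0 : 0 ≤ (k : ℝ) * D ^ 2 / m := by positivity
  have hR0 : 0 ≤ (m : ℝ) ^ 2 * ((D : ℝ) / m) ^ k := by positivity
  have hρ : (m : ℝ) ^ 2 * ((D : ℝ) / m) ^ k ≤ k * m ^ 2 * ((D : ℝ) / m) ^ k := by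
    rw [mul_assoc]; exact le_mul_of_one_le_left hR0 (by linarith)
  have hLδ : loopMean k m d * (8 * ((D : ℝ) / m)) ≤ 4 * (k * D ^ 2 / m) := by
    calc loopMean k m d * (8 * ((D : ℝ) / m)) ≤ k * D / 2 * (8 * ((D : ℝ) / m)) :=
          mul_le_mul_of_nonneg_right hL (by positivity)
      _ = 4 * (k * D ^ 2 / m) := by ring
  set κ : ℝ := (k : ℝ) * D ^ 2 / m
  set ρ : ℝ := k * m ^ 2 * ((D : ℝ) / m) ^ k
  set R : ℝ := (m : ℝ) ^ 2 * ((D : ℝ) / m) ^ k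
  set A : ℝ := ((edgeSeqs (Fin m) k d).card : ℝ)
  set I : ℝ := ((((edgeSeqs (Fin m) k d).filter fun F => Function.Injective F).card : ℕ) : ℝ)
  set L := loopMean k m d
  set W := configWeight k m d
  set Q := weightRatio k m d
  set T := ((n.choose k).descFactorial m : ℝ)
  set X := (((k : ℝ) - 1) / 2) *
        (1 - (n : ℝ) * sigmaSq (fun v => (d v : ℤ)) / ((k : ℝ) * m))
  set Y := ((k : ℝ) - 1) * (k * m) / (2 * n)
  set b := probB k n m p (fun v => (d v : ℤ))
  have hA0 : 0 ≤ A := Nat.cast_nonneg _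
  have hQ : 0 < Q := lt_of_lt_of_le (Real.exp_pos _) r1
  have hGT : G * T = W * Q * Real.exp X := by rw [hG, ← hB]; ring
  have hG0 : 0 < G := by
    have : 0 < G * T := by rw [hGT]; positivity
    exact pos_of_mul_pos_left this hT.le
  refine ⟨hG0, ?_, fun hE1 => ?_⟩
  · rw [div_le_iff₀ hT]
    calc I ≤ A := hle'
      _ ≤ Real.exp (-(L * (1 - 8 * ((D : ℝ) / m)))) * W := bnd.2
      _ ≤ Real.exp (-(Y + κ + 2 * ρ) + X + 5 * E) * W := by
          refine mul_le_mul_of_nonneg_right (Real.exp_le_exp.2 ?_) hW.le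
          nlinarith
      _ = Real.exp (-(Y + κ + 2 * ρ)) * (W * Real.exp X * Real.exp (5 * E)) := by
          rw [Real.exp_add, Real.exp_add]; ring
      _ ≤ Q * (W * Real.exp X * Real.exp (5 * E)) := by gcongr
      _ = G * T * Real.exp (5 * E) := by rw [hGT]; ring
      _ = G * Real.exp (5 * E) * T := by ring
  · rw [le_div_iff₀ hT]
    have hRE : Real.exp 46 * R ≤ Real.exp 46 * E := by
      refine mul_le_mul_of_nonneg_left ?_ (Real.exp_pos _).le
      linarith
    have hnn : 0 ≤ 1 - Real.exp 46 * E := by linarith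
    calc G * ((1 - Real.exp 46 * E) * Real.exp (-(4 * E))) * T
        = (W * Q * Real.exp X) * ((1 - Real.exp 46 * E) * Real.exp (-(4 * E))) := by
          rw [← hGT]; ring
      _ ≤ (W * Real.exp (-(Y - ρ)) * Real.exp X) *
            ((1 - Real.exp 46 * E) * Real.exp (-(4 * E))) := by gcongr
      _ = (1 - Real.exp 46 * E) * (Real.exp (-(Y - ρ) + X + -(4 * E)) * W) := by
          rw [Real.exp_add, Real.exp_add]; ring
      _ ≤ (1 - Real.exp 46 * E) * (Real.exp (-(L * (1 + 8 * ((D : ℝ) / m)))) * W) := by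
          refine mul_le_mul_of_nonneg_left (mul_le_mul_of_nonneg_right
            (Real.exp_le_exp.2 ?_) hW.le) hnn
          have : L * (1 + 8 * ((D : ℝ) / m)) = L + L * (8 * ((D : ℝ) / m)) := by ring
          linarith
      _ ≤ (1 - Real.exp 46 * E) * A := mul_le_mul_of_nonneg_left bnd.1 hnn
      _ ≤ A * (1 - Real.exp 46 * R) := by nlinarith
      _ ≤ I := inj

theorem two_le_log {n : ℕ} (hn : 8 ≤ n) : 2 ≤ Real.log n := by
  have h8 : (8 : ℝ) ≤ n := by exact_mod_cast hn
  rw [Real.le_log_iff_exp_le (by linarith)]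
  have h1 : Real.exp 2 = Real.exp 1 * Real.exp 1 := by rw [← Real.exp_add]; norm_num
  have h2 := Real.exp_one_lt_d9
  have h3 := Real.exp_pos 1
  rw [h1]
  nlinarith

/-- What `psi < 1` means for the sizes of the parameters. The logarithmic terms are needed only to
make `m` large. -/
theorem sizes_of_psi_lt_one (hn : 8 ≤ n) (hk : 3 ≤ k) (hm : 0 < m) (hD1 : 0 < D)
    (hψ : psi k n m D < 1) :
    32 * D ≤ m ∧ D ^ 2 ≤ m ∧ k ≤ m ∧ k * D ^ 2 ≤ 3 * m ∧
      (k : ℝ) * D ^ 2 / m + k * m ^ 2 * ((D : ℝ) / m) ^ k ≤ 6 * psi k n m D := by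
  have hl := two_le_log hn
  have hl9 : (512 : ℝ) ≤ Real.log n ^ 9 := by
    have := pow_le_pow_left₀ (by norm_num) hl 9
    linarith [show (2 : ℝ) ^ 9 = 512 by norm_num]
  have hl4 : (0 : ℝ) ≤ Real.log n ^ 4 := by positivity
  have hmr : (0 : ℝ) < m := by exact_mod_cast hm
  have hDr : (1 : ℝ) ≤ D := by exact_mod_cast hD1
  unfold psi at hψ ⊢
  split_ifs at hψ ⊢ with h3
  · subst h3
    have h1 : (D : ℝ) ^ 3 + Real.log n ^ 9 < m := by
      rwa [one_div, inv_mul_lt_iff₀ hmr, mul_one] at hψ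
    have h2 : D ^ 3 + 512 < m := by
      have : (D : ℝ) ^ 3 + 512 < m := by linarith
      exact_mod_cast this
    have h4 : D ^ 2 ≤ D ^ 3 := Nat.pow_le_pow_right hD1 (by norm_num)
    refine ⟨?_, by omega, by omega, by omega, ?_⟩
    · by_cases h : D ≤ 16
      · omega
      · have : 6 * 6 * D ≤ D * D * D := by gcongr <;> omega
        have : D ^ 3 = D * D * D := by ring
        omega
    · have e1 : ((3 : ℕ) : ℝ) * D ^ 2 / m + (3 : ℕ) * m ^ 2 * ((D : ℝ) / m) ^ 3 =
          (3 * D ^ 2 + 3 * D ^ 3) / m := by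
        push_cast
        field_simp
      rw [e1, div_le_iff₀ hmr]
      have e2 : 6 * (1 / (m : ℝ) * ((D : ℝ) ^ 3 + Real.log n ^ 9)) * m =
          6 * ((D : ℝ) ^ 3 + Real.log n ^ 9) := by field_simp
      rw [e2]
      have : (D : ℝ) ^ 2 ≤ D ^ 3 := by exact_mod_cast h4
      have : (0 : ℝ) ≤ (D : ℝ) ^ 3 := by positivity
      linarith
  · have hk4 : 4 ≤ k := by omega
    have hkr : (4 : ℝ) ≤ k := by exact_mod_cast hk4
    have h1 : (k : ℝ) ^ 2 * ((D : ℝ) ^ 2 + k * D * Real.log n ^ 4 + (k : ℝ) ^ 2 * Real.log n ^ 9) <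
        m := by
      rwa [div_mul_eq_mul_div, div_lt_iff₀ hmr, one_mul] at hψ
    have h0 : (0 : ℝ) ≤ k * D * Real.log n ^ 4 := by positivity
    have h2 : (k : ℝ) ^ 2 * (D ^ 2 + k ^ 2 * 512) < m := by
      refine lt_of_le_of_lt ?_ h1
      have : (k : ℝ) ^ 2 * 512 ≤ (k : ℝ) ^ 2 * Real.log n ^ 9 := by gcongr
      gcongr
      linarith
    have h2' : k ^ 2 * (D ^ 2 + k ^ 2 * 512) < m := by exact_mod_cast h2
    have hk2 : 4 * k ≤ k ^ 2 := by nlinarith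
    have hDD : D ≤ D ^ 2 := by nlinarith
    have h5 : k * D ^ 2 ≤ m := by nlinarith [Nat.zero_le (k ^ 2 * k ^ 2)]
    have h5r : (k : ℝ) * D ^ 2 ≤ m := by exact_mod_cast h5
    have hDm : (D : ℝ) ^ 2 ≤ m := by nlinarith [sq_nonneg (D : ℝ)]
    refine ⟨by nlinarith, by exact_mod_cast hDm, by nlinarith, by omega, ?_⟩
    have hD1m : (D : ℝ) / m ≤ 1 := by
      rw [div_le_one hmr]; nlinarith
    have e1 : (k : ℝ) * m ^ 2 * ((D : ℝ) / m) ^ k ≤ k * D ^ 2 / m := by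
      calc (k : ℝ) * m ^ 2 * ((D : ℝ) / m) ^ k ≤ k * m ^ 2 * ((D : ℝ) / m) ^ 4 := by
            refine mul_le_mul_of_nonneg_left ?_ (by positivity)
            exact pow_le_pow_of_le_one (by positivity) hD1m hk4
        _ = (k : ℝ) * D ^ 2 / m * ((D : ℝ) ^ 2 / m) := by field_simp
        _ ≤ (k : ℝ) * D ^ 2 / m * 1 := by
            refine mul_le_mul_of_nonneg_left ?_ (by positivity)
            rwa [div_le_one hmr]
        _ = (k : ℝ) * D ^ 2 / m := mul_one _
    have e2 : (k : ℝ) * D ^ 2 / m ≤ (k : ℝ) ^ 2 / m *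
        ((D : ℝ) ^ 2 + k * D * Real.log n ^ 4 + (k : ℝ) ^ 2 * Real.log n ^ 9) := by
      rw [div_mul_eq_mul_div]
      refine div_le_div_of_nonneg_right ?_ hmr.le
      have e3 : (0 : ℝ) ≤ (k : ℝ) ^ 2 * Real.log n ^ 9 := by positivity
      have e4 : (k : ℝ) ≤ k ^ 2 := by nlinarith
      calc (k : ℝ) * D ^ 2 ≤ k ^ 2 * D ^ 2 := by gcongr
        _ ≤ _ := by gcongr; linarith
    have e5 : (0 : ℝ) ≤ k * D ^ 2 / m := by positivity
    linarith

/-- The lower bound is void when `exp 46 * E > 1`; then the claimed error exceeds one, and `0 ≤ P`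
suffices. -/
theorem exists_relative_error {P G E ψ : ℝ} (hG : 0 < G) (hP : 0 ≤ P) (hE0 : 0 ≤ E)
    (hE : E ≤ 6 * ψ) (hψ : ψ ≤ 1) (up : P ≤ G * Real.exp (5 * E))
    (low : Real.exp 46 * E ≤ 1 → G * ((1 - Real.exp 46 * E) * Real.exp (-(4 * E))) ≤ P) :
    ∃ ε : ℝ, |ε| ≤ (30 * Real.exp 30 + 6 * Real.exp 46 + 24) * Real.sqrt ψ ∧ P = G * (1 + ε) := by
  have hψ0 : 0 ≤ ψ := by linarith
  have hsqrt : ψ ≤ Real.sqrt ψ := Real.le_sqrt_of_sq_le (by nlinarith)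
  have hx1 := Real.exp_pos 30
  have hx2 := Real.exp_pos 46
  refine ⟨P / G - 1, ?_, by field_simp; ring⟩
  refine le_trans ?_ (mul_le_mul_of_nonneg_left hsqrt (by positivity))
  rw [abs_le]
  constructor
  · by_cases h : Real.exp 46 * E ≤ 1
    · have h1 : (1 - Real.exp 46 * E) * Real.exp (-(4 * E)) ≤ P / G := by
        rw [le_div_iff₀ hG, mul_comm]; exact low h
      have h2 : (1 - Real.exp 46 * E) * (1 - 4 * E) ≤ P / G := by
        refine le_trans (mul_le_mul_of_nonneg_left ?_ (by linarith)) h1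
        linarith [Real.add_one_le_exp (-(4 * E))]
      have h3 : 0 ≤ Real.exp 46 * E * (4 * E) := by positivity
      have h4 : Real.exp 46 * E ≤ Real.exp 46 * (6 * ψ) := by gcongr
      have h5 : 0 ≤ Real.exp 30 * ψ := by positivity
      nlinarith
    · push Not at h
      have h1 : 0 ≤ P / G := div_nonneg hP hG.le
      have h4 : Real.exp 46 * E ≤ Real.exp 46 * (6 * ψ) := by gcongr
      have h5 : 0 ≤ Real.exp 30 * ψ := by positivity
      nlinarith
  · have h1 : P / G ≤ Real.exp (30 * ψ) := by
      rw [div_le_iff₀ hG, mul_comm]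
      refine up.trans (mul_le_mul_of_nonneg_left (Real.exp_le_exp.2 (by linarith)) hG.le)
    have h2 : Real.exp (30 * ψ) - 1 ≤ 30 * ψ * Real.exp (30 * ψ) := by
      have h3 := Real.one_sub_le_exp_neg (30 * ψ)
      have h4 := mul_le_mul_of_nonneg_right h3 (Real.exp_pos (30 * ψ)).le
      rw [← Real.exp_add, neg_add_cancel, Real.exp_zero] at h4
      linarith
    have h3 : 30 * ψ * Real.exp (30 * ψ) ≤ 30 * ψ * Real.exp 30 := by
      refine mul_le_mul_of_nonneg_left (Real.exp_le_exp.2 (by linarith)) (by linarith)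
    have h4 : 0 ≤ Real.exp 46 * ψ := by positivity
    nlinarith

end Assembly

end SparseHypergraph

theorem theoremt :
    ∃ C : ℝ, ∃ N : ℕ, ∀ n : ℕ, N ≤ n → ∀ k m D : ℕ, 3 ≤ k → 0 < m → 0 < D →
      SparseHypergraph.psi k n m D < 1 →
      ∀ d : Fin n → ℤ, ∑ v, d v = (k : ℤ) * m → (∀ v, d v ≤ (D : ℤ)) →
      ∀ p : unitInterval, 0 < p → p < 1 →
        ∃ ε : ℝ, |ε| ≤ C * Real.sqrt (SparseHypergraph.psi k n m D) ∧
          SparseHypergraph.probD k n m d =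
            SparseHypergraph.probB k n m p d *
              Real.exp ((((k : ℝ) - 1) / 2) *
                (1 - (n : ℝ) * SparseHypergraph.sigmaSq d / ((k : ℝ) * m))) * (1 + ε) := by
  -- for `n ≥ 8` one has `log n ≥ 2`, so `psi < 1` forces `m ≥ 512`
  refine ⟨30 * Real.exp 30 + 6 * Real.exp 46 + 24, 8, ?_⟩
  intro n hn k m D hk hm hD1 hψ d hs hD p hp0 hp1
  by_cases hneg : ∃ v, d v < 0
  · obtain ⟨v, hv⟩ := hneg
    refine ⟨0, ?_, ?_⟩
    · rw [abs_zero]; positivity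
    · rw [SparseHypergraph.probD_of_neg hv, SparseHypergraph.probB_of_neg hv]
      simp
  · push Not at hneg
    lift d to Fin n → ℕ using hneg
    beta_reduce at hs hD
    have hs' : ∑ v, d v = k * m := by exact_mod_cast hs
    have hD' : ∀ v, d v ≤ D := fun v => by exact_mod_cast hD v
    obtain ⟨h1, h2, h3, h4, h5⟩ := SparseHypergraph.sizes_of_psi_lt_one hn hk hm hD1 hψ
    obtain ⟨hG, up, low⟩ := SparseHypergraph.probD_bounds hp0 hp1 hk hD1 h1 h2 h3 h4 hs' hD' rfl rfl
    exact SparseHypergraph.exists_relative_error hG (by unfold SparseHypergraph.probD; positivity)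
      (by positivity) h5 hψ.le up low
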